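/- Let $R$ be a commutative ring with unity and let $C$ be an $R$-coalgebra that is flat as an $R$-module; $\otimes=\otimes_R$. For a right $C$-comodule $M$ and a left $C$-comodule $N$ let $M\square_C N=\ker(\varrho_M\otimes id_N-id_M\otimes\varrho_N)\subseteq M\otimes N$ be the cotensor product. Let $X$ be a right $C$-comodule which is * quasi-finite: the functor $-\otimes X$ from $R$-modules to right $C$-comodules has a left adjoint $h=h_C(X,-)$, with unit $\eta_M: M\to h(M)\otimes X$; * faithfully coflat: the functor $X\square_C-$ from left $C$-comodules to $R$-modules is exact and faithful; * an injector: the functor $-\otimes X$ maps injective $R$-modules to injective right $C$-comodules. Let $E=e_C(X)=h_C(X,X)$ be the coendomorphism coalgebra: its comultiplication and counit are the unique linear maps with $(\Delta\otimes id)\eta_X=(id\otimes\eta_X)\eta_X$ and $(\varepsilon\otimes id)\eta_X=(X\cong R\otimes X)$. Then $X$ is an $E$-$C$-bicomodule with left coaction $\eta_X$, and $h_C(X,C)$ is a $C$-$E$-bicomodule, whose left and right coactions $\varrho^-,\varrho^+$ are determined by $(\varrho^-\otimes id)\eta_C=(id\otimes\eta_C)\Delta_C$ and $(\varrho^+\otimes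 id)\eta_C=(id\otimes\eta_X)\eta_C$. Let $\delta_X: E\to X\square_C h_C(X,C)$ be the unique linear map with $(\delta_X\otimes id)\eta_X=(id\otimes\eta_C)\varrho_X$, and regard $\eta_C$ as a map $C\to h_C(X,C)\square_E X$. Then, for every choice of the left adjoint $h$, $(E,\,C,\,X,\,h_C(X,C),\,\delta_X,\,\eta_C)$ is a strict Morita–Takeuchi context. Here a strict Morita–Takeuchi context $(D,C,M,N,f,g)$ consists of $R$-flat coalgebras $D$, $C$, a $D$-$C$-bicomodule $M$ and a $C$-$D$-bicomodule $N$ and bijective bicomodule morphisms $f:D\to M\square_C N$, $g:C\to N\square_D M$ such that 1. $M$ and $N$ are flat $R$-modules; 2. $M\square_C N$ is pure in $M\otimes N$ and $N\square_D M$ is pure in $N\otimes M$; 3. the two maps $M\cong M\square_C C\xrightarrow{id\,\square\, g}M\square_C N\square_D M$ and $M\cong D\square_D M\xrightarrow{f\,\square\, id}M\square_C N\square_D M$ agree, and so do $N\cong N\square_D D\xrightarrow{id\,\square\, f}N\square_D M\square_C N$ and $N\cong C\square_C N\xrightarrow{g\,\square\, id}N\square_D M\square_C N$. Consequently $C$ is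 Morita–Takeuchi equivalent to $e_C(X)$: the categories of right comodules over $C$ and over $e_C(X)$ are equivalent, by an $R$-linear equivalence. -/

import Mathlib

open CategoryTheory TensorProduct

universe u

noncomputable section

namespace MoritaTakeuchi

/-! ## Comodules and bicomodules -/

/-- A right comodule over the `R`-coalgebra `C`. -/
structure RComod (R C : Type u) [CommRing R] [AddCommGroup C] [Module R C] [Coalgebra R C] where
  carrier : Type u
  [addCommGroup : AddCommGroup carrier]
  [module : Module R carrier]
  rcoact : carrier →ₗ[R] carrier ⊗[R] C
  rcoassoc : TensorProduct.assoc R carrier C C ∘ₗ rcoact.rTensor C ∘ₗ rcoact =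
    (Coalgebra.comul (R := R) (A := C)).lTensor carrier ∘ₗ rcoact
  rcounit : (Coalgebra.counit (R := R) (A := C)).lTensor carrier ∘ₗ rcoact =
    (TensorProduct.mk R carrier R).flip 1

/-- A left comodule over the `R`-coalgebra `C`. -/
structure LComod (R C : Type u) [CommRing R] [AddCommGroup C] [Module R C] [Coalgebra R C] where
  carrier : Type u
  [addCommGroup : AddCommGroup carrier]
  [module : Module R carrier]
  lcoact : carrier →ₗ[R] C ⊗[R] carrier
  lcoassoc : TensorProduct.assoc R C C carrier ∘ₗ
      (Coalgebra.comul (R := R) (A := C)).rTensor carrier ∘ₗ lcoact =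
    lcoact.lTensor C ∘ₗ lcoact
  lcounit : (Coalgebra.counit (R := R) (A := C)).rTensor carrier ∘ₗ lcoact =
    TensorProduct.mk R R carrier 1

attribute [instance] RComod.addCommGroup RComod.module LComod.addCommGroup LComod.module

/-- A `D`-`C`-bicomodule: a left `D`-comodule and right `C`-comodule whose coactions commute. -/
structure Bicomod (R D C : Type u) [CommRing R] [AddCommGroup D] [Module R D] [Coalgebra R D]
    [AddCommGroup C] [Module R C] [Coalgebra R C] extends LComod R D, RComod R C where
  coact_comm : TensorProduct.assoc R D carrier C ∘ₗ lcoact.rTensor C ∘ₗ rcoact =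
    rcoact.lTensor D ∘ₗ lcoact

section Categories

variable {R C : Type u} [CommRing R] [AddCommGroup C] [Module R C] [Coalgebra R C]

/-- The `R`-module of colinear maps between right comodules. -/
def RComod.colinear (M N : RComod R C) : Submodule R (M.carrier →ₗ[R] N.carrier) where
  carrier := {f | N.rcoact ∘ₗ f = f.rTensor C ∘ₗ M.rcoact}
  add_mem' {f g} hf hg := by
    simp only [Set.mem_ofPred_eq] at *
    rw [LinearMap.comp_add, hf, hg, LinearMap.rTensor_add, LinearMap.add_comp]
  zero_mem' := by simp
  smul_mem' r f hf := by
    simp only [Set.mem_ofPred_eq] at *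
    rw [LinearMap.comp_smul, hf, LinearMap.rTensor_smul, LinearMap.smul_comp]

/-- The `R`-module of colinear maps between left comodules. -/
def LComod.colinear (M N : LComod R C) : Submodule R (M.carrier →ₗ[R] N.carrier) where
  carrier := {f | N.lcoact ∘ₗ f = f.lTensor C ∘ₗ M.lcoact}
  add_mem' {f g} hf hg := by
    simp only [Set.mem_ofPred_eq] at *
    rw [LinearMap.comp_add, hf, hg, LinearMap.lTensor_add, LinearMap.add_comp]
  zero_mem' := by simp
  smul_mem' r f hf := by
    simp only [Set.mem_ofPred_eq] at *
    rw [LinearMap.comp_smul, hf, LinearMap.lTensor_smul, LinearMap.smul_comp]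

theorem RComod.mem_colinear {M N : RComod R C} {f : M.carrier →ₗ[R] N.carrier} :
    f ∈ RComod.colinear M N ↔ N.rcoact ∘ₗ f = f.rTensor C ∘ₗ M.rcoact := Iff.rfl

theorem LComod.mem_colinear {M N : LComod R C} {f : M.carrier →ₗ[R] N.carrier} :
    f ∈ LComod.colinear M N ↔ N.lcoact ∘ₗ f = f.lTensor C ∘ₗ M.lcoact := Iff.rfl

theorem RComod.comp_mem {M N P : RComod R C} {f : M.carrier →ₗ[R] N.carrier}
    {g : N.carrier →ₗ[R] P.carrier} (hg : g ∈ RComod.colinear N P)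
    (hf : f ∈ RComod.colinear M N) : g ∘ₗ f ∈ RComod.colinear M P := by
  rw [RComod.mem_colinear] at *
  rw [← LinearMap.comp_assoc, hg, LinearMap.comp_assoc, hf, LinearMap.rTensor_comp,
    LinearMap.comp_assoc]

theorem LComod.comp_mem {M N P : LComod R C} {f : M.carrier →ₗ[R] N.carrier}
    {g : N.carrier →ₗ[R] P.carrier} (hg : g ∈ LComod.colinear N P)
    (hf : f ∈ LComod.colinear M N) : g ∘ₗ f ∈ LComod.colinear M P := by
  rw [LComod.mem_colinear] at *
  rw [← LinearMap.comp_assoc, hg, LinearMap.comp_assoc, hf, LinearMap.lTensor_comp,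
    LinearMap.comp_assoc]

theorem RComod.id_mem (M : RComod R C) : LinearMap.id ∈ RComod.colinear M M := by
  simp [RComod.mem_colinear]

theorem LComod.id_mem (M : LComod R C) : LinearMap.id ∈ LComod.colinear M M := by
  simp [LComod.mem_colinear]

/-- The category of right `C`-comodules and colinear maps. -/
instance RComod.category : Category.{u} (RComod R C) where
  Hom M N := RComod.colinear M N
  id M := ⟨LinearMap.id, RComod.id_mem M⟩
  comp f g := ⟨g.1 ∘ₗ f.1, RComod.comp_mem g.2 f.2⟩

/-- The category of left `C`-comodules and colinear maps. -/
instance LComod.category : Category.{u} (LComod R C) where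
  Hom M N := LComod.colinear M N
  id M := ⟨LinearMap.id, LComod.id_mem M⟩
  comp f g := ⟨g.1 ∘ₗ f.1, LComod.comp_mem g.2 f.2⟩

/-- The linear map underlying a morphism of right comodules. -/
def RComod.lin {M N : RComod R C} (f : M ⟶ N) : M.carrier →ₗ[R] N.carrier := f.1

/-- The linear map underlying a morphism of left comodules. -/
def LComod.lin {M N : LComod R C} (f : M ⟶ N) : M.carrier →ₗ[R] N.carrier := f.1

instance RComod.preadditive : Preadditive (RComod R C) where
  homGroup M N := inferInstanceAs (AddCommGroup (RComod.colinear M N))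
  add_comp _ _ _ f f' g := Subtype.ext (LinearMap.comp_add f.1 f'.1 g.1)
  comp_add _ _ _ f g g' := Subtype.ext (LinearMap.add_comp f.1 g'.1 g.1)

instance RComod.linear : CategoryTheory.Linear R (RComod R C) where
  homModule M N := inferInstanceAs (Module R (RComod.colinear M N))
  smul_comp _ _ _ r f g := Subtype.ext (LinearMap.comp_smul g.1 r f.1)
  comp_smul _ _ _ f r g := Subtype.ext (LinearMap.smul_comp r g.1 f.1)

variable (R C) in
/-- `C` as a `C`-`C`-bicomodule through its comultiplication. -/
abbrev Bicomod.self : Bicomod R C C where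
  carrier := C
  lcoact := Coalgebra.comul
  lcoassoc := Coalgebra.coassoc
  lcounit := Coalgebra.rTensor_counit_comp_comul
  rcoact := Coalgebra.comul
  rcoassoc := Coalgebra.coassoc
  rcounit := Coalgebra.lTensor_counit_comp_comul
  coact_comm := Coalgebra.coassoc

/-- For an `R`-module `W` and a right comodule `X`, the right comodule `W ⊗ X` with coaction
`id ⊗ ρ`. -/
abbrev RComod.tensorObj (W : Type u) [AddCommGroup W] [Module R W] (X : RComod R C) :
    RComod R C where
  carrier := W ⊗[R] X.carrier
  rcoact := (TensorProduct.assoc R W X.carrier C).symm ∘ₗ X.rcoact.lTensor W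
  rcoassoc := by
    refine TensorProduct.ext' fun w x => ?_
    have h := LinearMap.congr_fun X.rcoassoc x
    simp only [LinearMap.comp_apply, LinearEquiv.coe_coe, LinearMap.lTensor_tmul] at h ⊢
    have h1 : ∀ t : X.carrier ⊗[R] C,
        (TensorProduct.assoc R (W ⊗[R] X.carrier) C C)
          (((TensorProduct.assoc R W X.carrier C).symm.toLinearMap ∘ₗ X.rcoact.lTensor W).rTensor C
            ((TensorProduct.assoc R W X.carrier C).symm (w ⊗ₜ t))) =
        (TensorProduct.assoc R W X.carrier (C ⊗[R] C)).symm
          (w ⊗ₜ (TensorProduct.assoc R X.carrier C C) (X.rcoact.rTensor C t)) := by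
      intro t
      induction t with
      | zero => simp
      | add a b ha hb => simp only [tmul_add, map_add, ha, hb]
      | tmul a c =>
        simp only [assoc_symm_tmul, LinearMap.rTensor_tmul, LinearMap.comp_apply,
          LinearMap.lTensor_tmul, LinearEquiv.coe_coe]
        induction X.rcoact a with
        | zero => simp
        | add a b ha hb => simp only [tmul_add, add_tmul, map_add, ha, hb]
        | tmul a d => simp
    have h2 : ∀ t : X.carrier ⊗[R] C,
        (Coalgebra.comul (R := R) (A := C)).lTensor (W ⊗[R] X.carrier)
            ((TensorProduct.assoc R W X.carrier C).symm (w ⊗ₜ t)) =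
        (TensorProduct.assoc R W X.carrier (C ⊗[R] C)).symm
          (w ⊗ₜ ((Coalgebra.comul (R := R) (A := C)).lTensor X.carrier t)) := by
      intro t
      induction t with
      | zero => simp
      | add a b ha hb => simp only [tmul_add, map_add, ha, hb]
      | tmul a c => simp
    rw [h1, h2, h]
  rcounit := by
    refine TensorProduct.ext' fun w x => ?_
    have h := LinearMap.congr_fun X.rcounit x
    simp only [LinearMap.comp_apply, LinearEquiv.coe_coe, LinearMap.lTensor_tmul,
      LinearMap.flip_apply, TensorProduct.mk_apply] at h ⊢
    have h2 : ∀ t : X.carrier ⊗[R] C,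
        (Coalgebra.counit (R := R) (A := C)).lTensor (W ⊗[R] X.carrier)
            ((TensorProduct.assoc R W X.carrier C).symm (w ⊗ₜ t)) =
        (TensorProduct.assoc R W X.carrier R).symm
          (w ⊗ₜ ((Coalgebra.counit (R := R) (A := C)).lTensor X.carrier t)) := by
      intro t
      induction t with
      | zero => simp
      | add a b ha hb => simp only [tmul_add, map_add, ha, hb]
      | tmul a c => simp
    rw [h2, h, assoc_symm_tmul]

/-- For an `R`-module `W` and a left comodule `X`, the left comodule `X ⊗ W` with coaction
`ρ ⊗ id`. -/
abbrev LComod.tensorObj (X : LComod R C) (W : Type u) [AddCommGroup W] [Module R W] :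
    LComod R C where
  carrier := X.carrier ⊗[R] W
  lcoact := (TensorProduct.assoc R C X.carrier W) ∘ₗ X.lcoact.rTensor W
  lcoassoc := by
    refine TensorProduct.ext' fun x w => ?_
    have h := LinearMap.congr_fun X.lcoassoc x
    simp only [LinearMap.comp_apply, LinearEquiv.coe_coe, LinearMap.rTensor_tmul] at h ⊢
    have h1 : ∀ t : C ⊗[R] X.carrier,
        (((TensorProduct.assoc R C X.carrier W).toLinearMap ∘ₗ X.lcoact.rTensor W).lTensor C
            ((TensorProduct.assoc R C X.carrier W) (t ⊗ₜ w))) =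
        (TensorProduct.assoc R C C (X.carrier ⊗[R] W))
          ((TensorProduct.assoc R (C ⊗[R] C) X.carrier W)
          (((TensorProduct.assoc R C C X.carrier).symm (X.lcoact.lTensor C t)) ⊗ₜ w)) := by
      intro t
      induction t with
      | zero => simp
      | add a b ha hb => simp only [add_tmul, map_add, ha, hb]
      | tmul c a =>
        simp only [assoc_tmul, LinearMap.lTensor_tmul, LinearMap.comp_apply,
          LinearMap.rTensor_tmul, LinearEquiv.coe_coe]
        induction X.lcoact a with
        | zero => simp
        | add a b ha hb => simp only [tmul_add, add_tmul, map_add, ha, hb]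
        | tmul a d => simp
    have h2 : ∀ t : C ⊗[R] X.carrier,
        (Coalgebra.comul (R := R) (A := C)).rTensor (X.carrier ⊗[R] W)
            ((TensorProduct.assoc R C X.carrier W) (t ⊗ₜ w)) =
        (TensorProduct.assoc R (C ⊗[R] C) X.carrier W)
          (((Coalgebra.comul (R := R) (A := C)).rTensor X.carrier t) ⊗ₜ w) := by
      intro t
      induction t with
      | zero => simp
      | add a b ha hb => simp only [add_tmul, map_add, ha, hb]
      | tmul a c => simp
    rw [h1, h2, ← h, LinearEquiv.symm_apply_apply]
  lcounit := by
    refine TensorProduct.ext' fun x w => ?_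
    have h := LinearMap.congr_fun X.lcounit x
    simp only [LinearMap.comp_apply, LinearEquiv.coe_coe, LinearMap.rTensor_tmul,
      TensorProduct.mk_apply] at h ⊢
    have h2 : ∀ t : C ⊗[R] X.carrier,
        (Coalgebra.counit (R := R) (A := C)).rTensor (X.carrier ⊗[R] W)
            ((TensorProduct.assoc R C X.carrier W) (t ⊗ₜ w)) =
        (TensorProduct.assoc R R X.carrier W)
          (((Coalgebra.counit (R := R) (A := C)).rTensor X.carrier t) ⊗ₜ w) := by
      intro t
      induction t with
      | zero => simp
      | add a b ha hb => simp only [add_tmul, map_add, ha, hb]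
      | tmul a c => simp
    rw [h2, h, assoc_tmul]

theorem RComod.rTensor_mem {W V : Type u} [AddCommGroup W] [Module R W] [AddCommGroup V]
    [Module R V] (f : W →ₗ[R] V) (X : RComod R C) :
    f.rTensor X.carrier ∈ RComod.colinear (RComod.tensorObj W X) (RComod.tensorObj V X) := by
  rw [RComod.mem_colinear]
  refine TensorProduct.ext' fun w x => ?_
  simp only [RComod.tensorObj, LinearMap.comp_apply, LinearMap.rTensor_tmul,
    LinearMap.lTensor_tmul, LinearEquiv.coe_coe]
  induction X.rcoact x with
  | zero => simp
  | add a b ha hb => simp only [tmul_add, map_add, ha, hb]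
  | tmul a c => simp

theorem RComod.lTensor_mem (W : Type u) [AddCommGroup W] [Module R W] {M N : RComod R C}
    {f : M.carrier →ₗ[R] N.carrier} (hf : f ∈ RComod.colinear M N) :
    f.lTensor W ∈ RComod.colinear (RComod.tensorObj W M) (RComod.tensorObj W N) := by
  rw [RComod.mem_colinear] at *
  refine TensorProduct.ext' fun w x => ?_
  have h := LinearMap.congr_fun hf x
  simp only [RComod.tensorObj, LinearMap.comp_apply, LinearMap.lTensor_tmul,
    LinearEquiv.coe_coe] at h ⊢
  rw [h]
  induction M.rcoact x with
  | zero => simp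
  | add a b ha hb => simp only [tmul_add, map_add, ha, hb]
  | tmul a c => simp

theorem RComod.assoc_symm_mem (W V : Type u) [AddCommGroup W] [Module R W] [AddCommGroup V]
    [Module R V] (X : RComod R C) :
    (TensorProduct.assoc R W V X.carrier).symm.toLinearMap ∈
      RComod.colinear (RComod.tensorObj W (RComod.tensorObj V X))
        (RComod.tensorObj (W ⊗[R] V) X) := by
  rw [RComod.mem_colinear]
  refine TensorProduct.ext' fun w t => ?_
  change V ⊗[R] X.carrier at t
  induction t with
  | zero => simp
  | add a b ha hb => simp only [tmul_add, map_add, ha, hb]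
  | tmul v x =>
    simp only [RComod.tensorObj, LinearMap.comp_apply, LinearMap.lTensor_tmul,
      LinearEquiv.coe_coe, assoc_symm_tmul]
    induction X.rcoact x with
    | zero => simp
    | add a b ha hb => simp only [tmul_add, map_add, ha, hb]
    | tmul a c => simp

theorem RComod.rcoact_mem (M : RComod R C) :
    M.rcoact ∈ RComod.colinear M
      (RComod.tensorObj M.carrier (Bicomod.self R C).toRComod) := by
  rw [RComod.mem_colinear]
  refine LinearMap.ext fun x => ?_
  have h := LinearMap.congr_fun M.rcoassoc x
  simp only [RComod.tensorObj, Bicomod.self, LinearMap.comp_apply, LinearEquiv.coe_coe] at h ⊢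
  rw [← h, LinearEquiv.symm_apply_apply]

/-- The functor `- ⊗ X` from `R`-modules to right `C`-comodules. -/
def tensorFunctor (X : RComod R C) : ModuleCat.{u} R ⥤ RComod R C where
  obj W := RComod.tensorObj W X
  map f := ⟨f.hom.rTensor X.carrier, RComod.rTensor_mem f.hom X⟩
  map_id W := Subtype.ext (LinearMap.rTensor_id X.carrier W)
  map_comp f g := Subtype.ext (LinearMap.rTensor_comp X.carrier g.hom f.hom)

/-! ## Cotensor product, coflatness, quasi-finiteness, injectors -/

/-- The cotensor product: the kernel of `ρ_M ⊗ id - id ⊗ ρ_N : M ⊗ N → M ⊗ (C ⊗ N)`. -/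
def cotensor (M : RComod R C) (N : LComod R C) : Submodule R (M.carrier ⊗[R] N.carrier) :=
  LinearMap.ker ((TensorProduct.assoc R M.carrier C N.carrier).toLinearMap ∘ₗ
    M.rcoact.rTensor N.carrier - N.lcoact.lTensor M.carrier)

theorem mem_cotensor {M : RComod R C} {N : LComod R C} {t : M.carrier ⊗[R] N.carrier} :
    t ∈ cotensor M N ↔ TensorProduct.assoc R M.carrier C N.carrier
      (M.rcoact.rTensor N.carrier t) = N.lcoact.lTensor M.carrier t := by
  simp [cotensor, sub_eq_zero]

theorem cotensor_map_mem (X : RComod R C) {N P : LComod R C} (f : N ⟶ P)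
    (t : X.carrier ⊗[R] N.carrier) (ht : t ∈ cotensor X N) :
    (LComod.lin f).lTensor X.carrier t ∈ cotensor X P := by
  rw [mem_cotensor] at *
  have hf : P.lcoact ∘ₗ LComod.lin f = (LComod.lin f).lTensor C ∘ₗ N.lcoact := f.2
  have h1 : ∀ s : X.carrier ⊗[R] N.carrier,
      TensorProduct.assoc R X.carrier C P.carrier
        (X.rcoact.rTensor P.carrier ((LComod.lin f).lTensor X.carrier s)) =
      ((LComod.lin f).lTensor C).lTensor X.carrier
        (TensorProduct.assoc R X.carrier C N.carrier (X.rcoact.rTensor N.carrier s)) := by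
    intro s
    induction s with
    | zero => simp
    | add a b ha hb => simp only [map_add, ha, hb]
    | tmul x n =>
      simp only [LinearMap.lTensor_tmul, LinearMap.rTensor_tmul]
      induction X.rcoact x with
      | zero => simp
      | add a b ha hb => simp only [add_tmul, map_add, ha, hb]
      | tmul a c => simp
  rw [h1, ht, ← LinearMap.comp_apply, ← LinearMap.lTensor_comp, ← hf, LinearMap.lTensor_comp,
    LinearMap.comp_apply]

/-- The cotensor functor `X □_C -` from left `C`-comodules to `R`-modules. -/
def cotensorFunctor (X : RComod R C) : LComod R C ⥤ ModuleCat.{u} R where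
  obj N := ModuleCat.of R (cotensor X N)
  map f := ModuleCat.ofHom
    (((LComod.lin f).lTensor X.carrier).restrict (cotensor_map_mem X f))
  map_id N := by
    refine ModuleCat.hom_ext (LinearMap.ext fun t => Subtype.ext ?_)
    exact LinearMap.congr_fun (LinearMap.lTensor_id X.carrier N.carrier) t.1
  map_comp f g := by
    refine ModuleCat.hom_ext (LinearMap.ext fun t => Subtype.ext ?_)
    exact LinearMap.congr_fun
      (LinearMap.lTensor_comp X.carrier (LComod.lin g) (LComod.lin f)) t.1

/-- `X` is coflat: the functor `X □_C -` is exact, i.e. it preserves short exact sequences. (For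
flat `C` a sequence of comodules is exact iff it is exact as a sequence of `R`-modules.) -/
def IsCoflat (X : RComod R C) : Prop :=
  ∀ ⦃N₁ N₂ N₃ : LComod R C⦄ (f : N₁ ⟶ N₂) (g : N₂ ⟶ N₃),
    Function.Injective (LComod.lin f) → Function.Exact (LComod.lin f) (LComod.lin g) →
    Function.Surjective (LComod.lin g) →
      Function.Injective ((cotensorFunctor X).map f).hom ∧
      Function.Exact ((cotensorFunctor X).map f).hom ((cotensorFunctor X).map g).hom ∧
      Function.Surjective ((cotensorFunctor X).map g).hom

/-- `X` is faithfully coflat: the functor `X □_C -` is exact and faithful. -/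
def IsFaithfullyCoflat (X : RComod R C) : Prop :=
  IsCoflat X ∧ (cotensorFunctor X).Faithful

/-- `X` is quasi-finite: the functor `- ⊗ X` from `R`-modules to comodules has a left adjoint. -/
def IsQuasiFinite (X : RComod R C) : Prop := (tensorFunctor X).IsRightAdjoint

/-- `X` is an injector: the functor `- ⊗ X` respects injective objects. -/
def IsInjector (X : RComod R C) : Prop := (tensorFunctor X).PreservesInjectiveObjects

end Categories

/-- Two coalgebras are Morita-Takeuchi equivalent if their categories of right comodules are
equivalent (as `R`-linear categories). -/
def MoritaTakeuchiEquivalent (R C D : Type u) [CommRing R] [AddCommGroup C] [Module R C]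
    [Coalgebra R C] [AddCommGroup D] [Module R D] [Coalgebra R D] : Prop :=
  ∃ e : RComod R C ≌ RComod R D, e.functor.Additive ∧ e.functor.Linear R

/-! ## The cohom functor

In this section `h` is a left adjoint of `- ⊗ X` (the cohom functor `h_C(X,-)`). -/

section Cohom

variable {R C : Type u} [CommRing R] [AddCommGroup C] [Module R C] [Coalgebra R C]
variable {X : RComod R C} {h : RComod R C ⥤ ModuleCat.{u} R} (adj : h ⊣ tensorFunctor X)

/-- The unit of adjunction `η_M : M → h(M) ⊗ X`. -/
def eta (M : RComod R C) : M.carrier →ₗ[R] h.obj M ⊗[R] X.carrier :=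
  RComod.lin (adj.unit.app M)

theorem eta_mem (M : RComod R C) :
    eta adj M ∈ RComod.colinear M (RComod.tensorObj (h.obj M) X) :=
  (adj.unit.app M).2

/-- The linear map `h(M) → W` that corresponds to a colinear map `M → W ⊗ X`. -/
def desc {M : RComod R C} {W : Type u} [AddCommGroup W] [Module R W]
    (f : M.carrier →ₗ[R] W ⊗[R] X.carrier)
    (hf : f ∈ RComod.colinear M (RComod.tensorObj W X)) : h.obj M →ₗ[R] W :=
  ((adj.homEquiv M (ModuleCat.of R W)).symm ⟨f, hf⟩).hom

theorem desc_spec {M : RComod R C} {W : Type u} [AddCommGroup W] [Module R W]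
    (f : M.carrier →ₗ[R] W ⊗[R] X.carrier)
    (hf : f ∈ RComod.colinear M (RComod.tensorObj W X)) :
    (desc adj f hf).rTensor X.carrier ∘ₗ eta adj M = f := by
  have h1 := (adj.homEquiv M (ModuleCat.of R W)).apply_symm_apply ⟨f, hf⟩
  rw [Adjunction.homEquiv_unit] at h1
  exact congrArg Subtype.val h1

theorem desc_apply {M : RComod R C} {W : Type u} [AddCommGroup W] [Module R W]
    (f : M.carrier →ₗ[R] W ⊗[R] X.carrier)
    (hf : f ∈ RComod.colinear M (RComod.tensorObj W X)) (m : M.carrier) :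
    (desc adj f hf).rTensor X.carrier (eta adj M m) = f m :=
  LinearMap.congr_fun (desc_spec adj f hf) m

theorem cohom_ext {M : RComod R C} {W : Type u} [AddCommGroup W] [Module R W]
    {p q : h.obj M →ₗ[R] W}
    (hpq : ∀ m, p.rTensor X.carrier (eta adj M m) = q.rTensor X.carrier (eta adj M m)) :
    p = q := by
  have h1 : (adj.homEquiv M (ModuleCat.of R W)) (ModuleCat.ofHom p) =
      (adj.homEquiv M (ModuleCat.of R W)) (ModuleCat.ofHom q) := by
    rw [Adjunction.homEquiv_unit, Adjunction.homEquiv_unit]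
    exact Subtype.ext (LinearMap.ext hpq)
  have h2 := (adj.homEquiv M (ModuleCat.of R W)).injective h1
  exact congrArg ModuleCat.Hom.hom h2

theorem coactMap_mem (M : RComod R C) :
    (TensorProduct.assoc R (h.obj M) (h.obj X) X.carrier).symm.toLinearMap ∘ₗ
      (eta adj X).lTensor (h.obj M) ∘ₗ eta adj M ∈
    RComod.colinear M (RComod.tensorObj (h.obj M ⊗[R] h.obj X) X) :=
  RComod.comp_mem (N := RComod.tensorObj (h.obj M) (RComod.tensorObj (h.obj X) X))
    (RComod.assoc_symm_mem (h.obj M) (h.obj X) X)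
    (RComod.comp_mem (N := RComod.tensorObj (h.obj M) X)
      (RComod.lTensor_mem (h.obj M) (eta_mem adj X)) (eta_mem adj M))

/-- The map `ρ_h : h(M) → h(M) ⊗ h(X)` determined by `(ρ_h ⊗ id) η_M = (id ⊗ η_X) η_M`. For
`M = X` it is the comultiplication of the coendomorphism coalgebra. -/
def coactMap (M : RComod R C) : h.obj M →ₗ[R] h.obj M ⊗[R] h.obj X :=
  desc adj _ (coactMap_mem adj M)

theorem coactMap_eta (M : RComod R C) (m : M.carrier) :
    (coactMap adj M).rTensor X.carrier (eta adj M m) =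
      (TensorProduct.assoc R (h.obj M) (h.obj X) X.carrier).symm
        ((eta adj X).lTensor (h.obj M) (eta adj M m)) :=
  desc_apply adj _ (coactMap_mem adj M) m

theorem counitMap_mem : TensorProduct.mk R R X.carrier 1 ∈
    RComod.colinear X (RComod.tensorObj R X) := by
  rw [RComod.mem_colinear]
  refine LinearMap.ext fun x => ?_
  simp only [RComod.tensorObj, LinearMap.comp_apply, LinearMap.lTensor_tmul,
    LinearEquiv.coe_coe, TensorProduct.mk_apply]
  induction X.rcoact x with
  | zero => simp
  | add a b ha hb => simp only [tmul_add, map_add, ha, hb]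
  | tmul a c => simp

/-- The map `h(X) → R` that corresponds to the canonical map `X ≅ R ⊗ X`. -/
def counitMap : h.obj X →ₗ[R] R :=
  desc adj (TensorProduct.mk R R X.carrier 1) counitMap_mem

theorem counitMap_eta (x : X.carrier) :
    (counitMap adj).rTensor X.carrier (eta adj X x) = 1 ⊗ₜ x :=
  desc_apply adj _ counitMap_mem x

theorem coactMap_coassoc (M : RComod R C) :
    TensorProduct.assoc R (h.obj M) (h.obj X) (h.obj X) ∘ₗ
      (coactMap adj M).rTensor (h.obj X) ∘ₗ coactMap adj M =
    (coactMap adj X).lTensor (h.obj M) ∘ₗ coactMap adj M := by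
  refine cohom_ext adj fun m => ?_
  simp only [LinearMap.rTensor_comp, LinearMap.comp_apply, coactMap_eta]
  have h1 : ∀ s : h.obj M ⊗[R] X.carrier,
      ((coactMap adj M).rTensor (h.obj X)).rTensor X.carrier
        ((TensorProduct.assoc R (h.obj M) (h.obj X) X.carrier).symm
          ((eta adj X).lTensor (h.obj M) s)) =
      (TensorProduct.assoc R (h.obj M ⊗[R] h.obj X) (h.obj X) X.carrier).symm
        ((eta adj X).lTensor (h.obj M ⊗[R] h.obj X) ((coactMap adj M).rTensor X.carrier s)) := by
    intro s
    induction s with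
    | zero => simp
    | add a b ha hb => simp only [map_add, ha, hb]
    | tmul a x =>
      simp only [LinearMap.lTensor_tmul, LinearMap.rTensor_tmul]
      induction eta adj X x with
      | zero => simp
      | add a b ha hb => simp only [tmul_add, map_add, ha, hb]
      | tmul e y => simp
  have h2 : ∀ s : h.obj M ⊗[R] X.carrier,
      ((coactMap adj X).lTensor (h.obj M)).rTensor X.carrier
        ((TensorProduct.assoc R (h.obj M) (h.obj X) X.carrier).symm
          ((eta adj X).lTensor (h.obj M) s)) =
      (TensorProduct.assoc R (h.obj M) (h.obj X ⊗[R] h.obj X) X.carrier).symm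
        (((coactMap adj X).rTensor X.carrier ∘ₗ eta adj X).lTensor (h.obj M) s) := by
    intro s
    induction s with
    | zero => simp
    | add a b ha hb => simp only [map_add, ha, hb]
    | tmul a x =>
      simp only [LinearMap.lTensor_tmul, LinearMap.comp_apply]
      induction eta adj X x with
      | zero => simp
      | add a b ha hb => simp only [tmul_add, map_add, ha, hb]
      | tmul e y => simp
  have h3 : (coactMap adj X).rTensor X.carrier ∘ₗ eta adj X =
      (TensorProduct.assoc R (h.obj X) (h.obj X) X.carrier).symm.toLinearMap ∘ₗ
        (eta adj X).lTensor (h.obj X) ∘ₗ eta adj X :=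
    LinearMap.ext (coactMap_eta adj X)
  rw [h1, h2, h3, coactMap_eta]
  induction eta adj M m with
  | zero => simp
  | add a b ha hb => simp only [map_add, ha, hb]
  | tmul a x =>
    simp only [LinearMap.lTensor_tmul, LinearMap.comp_apply, LinearEquiv.coe_coe]
    induction eta adj X x with
    | zero => simp
    | add a b ha hb => simp only [tmul_add, map_add, ha, hb]
    | tmul e y =>
      simp only [LinearMap.lTensor_tmul, assoc_symm_tmul]
      induction eta adj X y with
      | zero => simp
      | add a b ha hb => simp only [tmul_add, map_add, ha, hb]
      | tmul e' z => simp

theorem coactMap_counit (M : RComod R C) :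
    (counitMap adj).lTensor (h.obj M) ∘ₗ coactMap adj M =
      (TensorProduct.mk R (h.obj M) R).flip 1 := by
  refine cohom_ext adj fun m => ?_
  simp only [LinearMap.rTensor_comp, LinearMap.comp_apply, coactMap_eta]
  induction eta adj M m with
  | zero => simp
  | add a b ha hb => simp only [map_add, ha, hb]
  | tmul a x =>
    have h1 : ∀ t : h.obj X ⊗[R] X.carrier,
        ((counitMap adj).lTensor (h.obj M)).rTensor X.carrier
          ((TensorProduct.assoc R (h.obj M) (h.obj X) X.carrier).symm (a ⊗ₜ t)) =
        (TensorProduct.assoc R (h.obj M) R X.carrier).symm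
          (a ⊗ₜ (counitMap adj).rTensor X.carrier t) := by
      intro t
      induction t with
      | zero => simp
      | add a b ha hb => simp only [tmul_add, map_add, ha, hb]
      | tmul e y => simp
    rw [LinearMap.lTensor_tmul, h1, counitMap_eta]
    simp

theorem counit_coactMap :
    (counitMap adj).rTensor (h.obj X) ∘ₗ coactMap adj X = TensorProduct.mk R R (h.obj X) 1 := by
  refine cohom_ext adj fun m => ?_
  simp only [LinearMap.rTensor_comp, LinearMap.comp_apply, coactMap_eta]
  have h1 : ∀ s : h.obj X ⊗[R] X.carrier,
      ((counitMap adj).rTensor (h.obj X)).rTensor X.carrier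
        ((TensorProduct.assoc R (h.obj X) (h.obj X) X.carrier).symm
          ((eta adj X).lTensor (h.obj X) s)) =
      (TensorProduct.assoc R R (h.obj X) X.carrier).symm
        ((eta adj X).lTensor R ((counitMap adj).rTensor X.carrier s)) := by
    intro s
    induction s with
    | zero => simp
    | add a b ha hb => simp only [map_add, ha, hb]
    | tmul a x =>
      simp only [LinearMap.lTensor_tmul, LinearMap.rTensor_tmul]
      induction eta adj X x with
      | zero => simp
      | add a b ha hb => simp only [tmul_add, map_add, ha, hb]
      | tmul e y => simp
  rw [h1, counitMap_eta, LinearMap.lTensor_tmul]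
  induction eta adj X m with
  | zero => simp
  | add a b ha hb => simp only [tmul_add, map_add, ha, hb]
  | tmul e y => simp

/-- The `R`-module `e_C(X) = h_C(X,X)` underlying the coendomorphism coalgebra. -/
@[nolint unusedArguments]
def Coend (_adj : h ⊣ tensorFunctor X) : Type u := h.obj X

instance : AddCommGroup (Coend adj) := inferInstanceAs (AddCommGroup (h.obj X))

instance : Module R (Coend adj) := inferInstanceAs (Module R (h.obj X))

/-- The coendomorphism coalgebra `e_C(X)`: the comultiplication corresponds to
`(id ⊗ η_X) η_X`, the counit to `X ≅ R ⊗ X`. -/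
instance : Coalgebra R (Coend adj) where
  comul := coactMap adj X
  counit := counitMap adj
  coassoc := coactMap_coassoc adj X
  rTensor_counit_comp_comul := counit_coactMap adj
  lTensor_counit_comp_comul := coactMap_counit adj X

/-- `X` as an `e_C(X)`-`C`-bicomodule, with left coaction `η_X`. -/
def coendBicomod : Bicomod R (Coend adj) C where
  toLComod :=
    { carrier := X.carrier
      lcoact := eta adj X
      lcoassoc := by
        refine LinearMap.ext fun x => ?_
        have h1 := congrArg (TensorProduct.assoc R (h.obj X) (h.obj X) X.carrier)
          (coactMap_eta adj X x)
        rw [LinearEquiv.apply_symm_apply] at h1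
        exact h1
      lcounit := LinearMap.ext (counitMap_eta adj) }
  rcoact := X.rcoact
  rcoassoc := X.rcoassoc
  rcounit := X.rcounit
  coact_comm := by
    refine LinearMap.ext fun x => ?_
    have h1 := LinearMap.congr_fun (RComod.mem_colinear.1 (eta_mem adj X)) x
    have h2 := congrArg (TensorProduct.assoc R (h.obj X) X.carrier C) h1
    simp only [RComod.tensorObj, LinearMap.comp_apply, LinearEquiv.coe_coe,
      LinearEquiv.apply_symm_apply] at h2
    exact h2.symm

section Bicomodule

variable {D : Type u} [AddCommGroup D] [Module R D] [Coalgebra R D]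

theorem Bicomod.lcoact_mem (M : Bicomod R D C) :
    M.lcoact ∈ RComod.colinear M.toRComod (RComod.tensorObj D M.toRComod) := by
  rw [RComod.mem_colinear]
  refine LinearMap.ext fun x => ?_
  have h1 := LinearMap.congr_fun M.coact_comm x
  simp only [RComod.tensorObj, LinearMap.comp_apply, LinearEquiv.coe_coe] at h1 ⊢
  rw [← h1, LinearEquiv.symm_apply_apply]

theorem lcoactMap_mem (M : Bicomod R D C) :
    (TensorProduct.assoc R D (h.obj M.toRComod) X.carrier).symm.toLinearMap ∘ₗ
      (eta adj M.toRComod).lTensor D ∘ₗ M.lcoact ∈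
    RComod.colinear M.toRComod (RComod.tensorObj (D ⊗[R] h.obj M.toRComod) X) :=
  RComod.comp_mem (N := RComod.tensorObj D (RComod.tensorObj (h.obj M.toRComod) X))
    (RComod.assoc_symm_mem D (h.obj M.toRComod) X)
    (RComod.comp_mem (N := RComod.tensorObj D M.toRComod)
      (RComod.lTensor_mem D (eta_mem adj M.toRComod)) M.lcoact_mem)

/-- For a `D`-`C`-bicomodule `M`, the left coaction `h(M) → D ⊗ h(M)`: the map `h(ρ_M)` followed
by the canonical isomorphism `λ : h(D ⊗ M) ≅ D ⊗ h(M)`, that is, the unique linear map `ρ` with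
`(ρ ⊗ id) η_M = (id ⊗ η_M) ρ_M`. -/
def lcoactMap (M : Bicomod R D C) : h.obj M.toRComod →ₗ[R] D ⊗[R] h.obj M.toRComod :=
  desc adj _ (lcoactMap_mem adj M)

theorem lcoactMap_eta (M : Bicomod R D C) (m : M.carrier) :
    (lcoactMap adj M).rTensor X.carrier (eta adj M.toRComod m) =
      (TensorProduct.assoc R D (h.obj M.toRComod) X.carrier).symm
        ((eta adj M.toRComod).lTensor D (M.lcoact m)) :=
  desc_apply adj _ (lcoactMap_mem adj M) m

theorem lcoactMap_coassoc (M : Bicomod R D C) :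
    TensorProduct.assoc R D D (h.obj M.toRComod) ∘ₗ
      (Coalgebra.comul (R := R) (A := D)).rTensor (h.obj M.toRComod) ∘ₗ lcoactMap adj M =
    (lcoactMap adj M).lTensor D ∘ₗ lcoactMap adj M := by
  refine cohom_ext adj fun m => ?_
  simp only [LinearMap.rTensor_comp, LinearMap.comp_apply]
  erw [lcoactMap_eta adj M m]
  have h1 : ∀ s : D ⊗[R] M.carrier,
      ((TensorProduct.assoc R D D (h.obj M.toRComod)).toLinearMap).rTensor X.carrier
        (((Coalgebra.comul (R := R) (A := D)).rTensor (h.obj M.toRComod)).rTensor X.carrier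
          ((TensorProduct.assoc R D (h.obj M.toRComod) X.carrier).symm
            ((eta adj M.toRComod).lTensor D s))) =
      (TensorProduct.assoc R D (D ⊗[R] h.obj M.toRComod) X.carrier).symm
        (((TensorProduct.assoc R D (h.obj M.toRComod) X.carrier).symm.toLinearMap ∘ₗ
          (eta adj M.toRComod).lTensor D).lTensor D
          (TensorProduct.assoc R D D M.carrier
            ((Coalgebra.comul (R := R) (A := D)).rTensor M.carrier s))) := by
    intro s
    induction s with
    | zero => simp
    | add a b ha hb => simp only [map_add, ha, hb]
    | tmul a x =>
      simp only [LinearMap.lTensor_tmul, LinearMap.rTensor_tmul]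
      have h0 : ∀ t : h.obj M.toRComod ⊗[R] X.carrier,
          ((Coalgebra.comul (R := R) (A := D)).rTensor (h.obj M.toRComod)).rTensor X.carrier
            ((TensorProduct.assoc R D (h.obj M.toRComod) X.carrier).symm (a ⊗ₜ t)) =
          (TensorProduct.assoc R (D ⊗[R] D) (h.obj M.toRComod) X.carrier).symm
            (Coalgebra.comul (R := R) a ⊗ₜ t) := by
        intro t
        induction t with
        | zero => simp
        | add a b ha hb => simp only [tmul_add, map_add, ha, hb]
        | tmul e y => simp
      rw [h0]
      induction Coalgebra.comul (R := R) a with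
      | zero => simp
      | add a b ha hb => simp only [add_tmul, map_add, ha, hb]
      | tmul d d' =>
        simp only [LinearMap.lTensor_tmul, LinearMap.comp_apply, assoc_tmul, LinearEquiv.coe_coe]
        induction eta adj M.toRComod x with
        | zero => simp
        | add a b ha hb => simp only [tmul_add, map_add, ha, hb]
        | tmul e y => simp
  have h2 : ∀ s : D ⊗[R] M.carrier,
      ((lcoactMap adj M).lTensor D).rTensor X.carrier
        ((TensorProduct.assoc R D (h.obj M.toRComod) X.carrier).symm
          ((eta adj M.toRComod).lTensor D s)) =
      (TensorProduct.assoc R D (D ⊗[R] h.obj M.toRComod) X.carrier).symm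
        (((TensorProduct.assoc R D (h.obj M.toRComod) X.carrier).symm.toLinearMap ∘ₗ
          (eta adj M.toRComod).lTensor D).lTensor D (M.lcoact.lTensor D s)) := by
    intro s
    induction s with
    | zero => simp
    | add a b ha hb => simp only [map_add, ha, hb]
    | tmul a x =>
      simp only [LinearMap.lTensor_tmul, LinearMap.comp_apply, LinearEquiv.coe_coe]
      rw [← lcoactMap_eta]
      induction eta adj M.toRComod x with
      | zero => simp
      | add a b ha hb => simp only [tmul_add, map_add, ha, hb]
      | tmul e y => simp
  have h3 := LinearMap.congr_fun M.lcoassoc m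
  simp only [LinearMap.comp_apply, LinearEquiv.coe_coe] at h3
  rw [h1, h2, h3]

theorem lcoactMap_counit (M : Bicomod R D C) :
    (Coalgebra.counit (R := R) (A := D)).rTensor (h.obj M.toRComod) ∘ₗ lcoactMap adj M =
      TensorProduct.mk R R (h.obj M.toRComod) 1 := by
  refine cohom_ext adj fun m => ?_
  simp only [LinearMap.rTensor_comp, LinearMap.comp_apply]
  erw [lcoactMap_eta adj M m]
  have h1 : ∀ s : D ⊗[R] M.carrier,
      ((Coalgebra.counit (R := R) (A := D)).rTensor (h.obj M.toRComod)).rTensor X.carrier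
        ((TensorProduct.assoc R D (h.obj M.toRComod) X.carrier).symm
          ((eta adj M.toRComod).lTensor D s)) =
      (TensorProduct.assoc R R (h.obj M.toRComod) X.carrier).symm
        ((eta adj M.toRComod).lTensor R
          ((Coalgebra.counit (R := R) (A := D)).rTensor M.carrier s)) := by
    intro s
    induction s with
    | zero => simp
    | add a b ha hb => simp only [map_add, ha, hb]
    | tmul a x =>
      simp only [LinearMap.lTensor_tmul, LinearMap.rTensor_tmul]
      induction eta adj M.toRComod x with
      | zero => simp
      | add a b ha hb => simp only [tmul_add, map_add, ha, hb]
      | tmul e y => simp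
  have h3 := LinearMap.congr_fun M.lcounit m
  simp only [LinearMap.comp_apply, TensorProduct.mk_apply] at h3
  rw [h1, h3, LinearMap.lTensor_tmul]
  induction eta adj M.toRComod m with
  | zero => simp
  | add a b ha hb => simp only [tmul_add, map_add, ha, hb]
  | tmul e y => simp

theorem lcoactMap_coactMap (M : Bicomod R D C) :
    TensorProduct.assoc R D (h.obj M.toRComod) (h.obj X) ∘ₗ
      (lcoactMap adj M).rTensor (h.obj X) ∘ₗ coactMap adj M.toRComod =
    (coactMap adj M.toRComod).lTensor D ∘ₗ lcoactMap adj M := by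
  refine cohom_ext adj fun m => ?_
  simp only [LinearMap.rTensor_comp, LinearMap.comp_apply]
  erw [lcoactMap_eta adj M m, coactMap_eta adj M.toRComod m]
  have h1 : ∀ s : h.obj M.toRComod ⊗[R] X.carrier,
      ((lcoactMap adj M).rTensor (h.obj X)).rTensor X.carrier
        ((TensorProduct.assoc R (h.obj M.toRComod) (h.obj X) X.carrier).symm
          ((eta adj X).lTensor (h.obj M.toRComod) s)) =
      (TensorProduct.assoc R (D ⊗[R] h.obj M.toRComod) (h.obj X) X.carrier).symm
        ((eta adj X).lTensor (D ⊗[R] h.obj M.toRComod)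
          ((lcoactMap adj M).rTensor X.carrier s)) := by
    intro s
    induction s with
    | zero => simp
    | add a b ha hb => simp only [map_add, ha, hb]
    | tmul a x =>
      simp only [LinearMap.lTensor_tmul, LinearMap.rTensor_tmul]
      induction eta adj X x with
      | zero => simp
      | add a b ha hb => simp only [tmul_add, map_add, ha, hb]
      | tmul e y => simp
  rw [h1, lcoactMap_eta]
  induction M.lcoact m with
  | zero => simp
  | add a b ha hb => simp only [map_add, ha, hb]
  | tmul d x =>
    simp only [LinearMap.lTensor_tmul]
    have h2 : ∀ s : h.obj M.toRComod ⊗[R] X.carrier,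
        ((coactMap adj M.toRComod).lTensor D).rTensor X.carrier
          ((TensorProduct.assoc R D (h.obj M.toRComod) X.carrier).symm (d ⊗ₜ s)) =
        (TensorProduct.assoc R D (h.obj M.toRComod ⊗[R] h.obj X) X.carrier).symm
          (d ⊗ₜ (coactMap adj M.toRComod).rTensor X.carrier s) := by
      intro s
      induction s with
      | zero => simp
      | add a b ha hb => simp only [tmul_add, map_add, ha, hb]
      | tmul e y => simp
    rw [h2, coactMap_eta]
    induction eta adj M.toRComod x with
    | zero => simp
    | add a b ha hb => simp only [tmul_add, map_add, ha, hb]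
    | tmul e y =>
      simp only [LinearMap.lTensor_tmul, assoc_symm_tmul]
      induction eta adj X y with
      | zero => simp
      | add a b ha hb => simp only [tmul_add, map_add, ha, hb]
      | tmul e' z => simp

/-- For a `D`-`C`-bicomodule `M`, the `D`-`e_C(X)`-bicomodule `h(M)`. -/
def cohomBicomod (M : Bicomod R D C) : Bicomod R D (Coend adj) where
  toLComod :=
    { carrier := h.obj M.toRComod
      lcoact := lcoactMap adj M
      lcoassoc := lcoactMap_coassoc adj M
      lcounit := lcoactMap_counit adj M }
  rcoact := coactMap adj M.toRComod
  rcoassoc := coactMap_coassoc adj M.toRComod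
  rcounit := coactMap_counit adj M.toRComod
  coact_comm := lcoactMap_coactMap adj M

end Bicomodule

/-- The right `e_C(X)`-comodule `h(M)`, for a right `C`-comodule `M`. -/
def cohomRComod (M : RComod R C) : RComod R (Coend adj) where
  carrier := h.obj M
  rcoact := coactMap adj M
  rcoassoc := coactMap_coassoc adj M
  rcounit := coactMap_counit adj M

variable (C) in
/-- The `C`-`e_C(X)`-bicomodule `h_C(X,C)`. -/
abbrev cohomSelf : Bicomod R C (Coend adj) := cohomBicomod adj (Bicomod.self R C)

theorem deltaMap_mem (M : RComod R C) :
    (TensorProduct.assoc R M.carrier (h.obj (Bicomod.self R C).toRComod) X.carrier).symm.toLinearMap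
      ∘ₗ (eta adj (Bicomod.self R C).toRComod).lTensor M.carrier ∘ₗ M.rcoact ∈
    RComod.colinear M
      (RComod.tensorObj (M.carrier ⊗[R] h.obj (Bicomod.self R C).toRComod) X) :=
  RComod.comp_mem
    (N := RComod.tensorObj M.carrier (RComod.tensorObj (h.obj (Bicomod.self R C).toRComod) X))
    (RComod.assoc_symm_mem M.carrier (h.obj (Bicomod.self R C).toRComod) X)
    (RComod.comp_mem (N := RComod.tensorObj M.carrier (Bicomod.self R C).toRComod)
      (RComod.lTensor_mem M.carrier (eta_mem adj (Bicomod.self R C).toRComod)) M.rcoact_mem)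

/-- The unique linear map `δ : h(M) → M ⊗ h(C)` with `(δ ⊗ id) η_M = (id ⊗ η_C) ρ_M`. -/
def deltaMap (M : RComod R C) :
    h.obj M →ₗ[R] M.carrier ⊗[R] h.obj (Bicomod.self R C).toRComod :=
  desc adj _ (deltaMap_mem adj M)

theorem deltaMap_eta (M : RComod R C) (m : M.carrier) :
    (deltaMap adj M).rTensor X.carrier (eta adj M m) =
      (TensorProduct.assoc R M.carrier (h.obj (Bicomod.self R C).toRComod) X.carrier).symm
        ((eta adj (Bicomod.self R C).toRComod).lTensor M.carrier (M.rcoact m)) :=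
  desc_apply adj _ (deltaMap_mem adj M) m

theorem deltaMap_cotensor_aux {V K Y : Type u} [AddCommGroup V] [Module R V] [AddCommGroup K]
    [Module R K] [AddCommGroup Y] [Module R Y] (p : V →ₗ[R] V ⊗[R] C) (q : C →ₗ[R] K ⊗[R] Y)
    (l : K →ₗ[R] C ⊗[R] K)
    (hl : ∀ c, l.rTensor Y (q c) = (TensorProduct.assoc R C K Y).symm
      (q.lTensor C (Coalgebra.comul (R := R) c)))
    (v : V) (hv : TensorProduct.assoc R V C C (p.rTensor C (p v)) =
      (Coalgebra.comul (R := R) (A := C)).lTensor V (p v)) :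
    (TensorProduct.assoc R V C K).toLinearMap.rTensor Y
      ((p.rTensor K).rTensor Y ((TensorProduct.assoc R V K Y).symm (q.lTensor V (p v)))) =
    (l.lTensor V).rTensor Y ((TensorProduct.assoc R V K Y).symm (q.lTensor V (p v))) := by
  have h1 : ∀ s : V ⊗[R] C,
      (TensorProduct.assoc R V C K).toLinearMap.rTensor Y
        ((p.rTensor K).rTensor Y ((TensorProduct.assoc R V K Y).symm (q.lTensor V s))) =
      (TensorProduct.assoc R V (C ⊗[R] K) Y).symm
        (((TensorProduct.assoc R C K Y).symm.toLinearMap ∘ₗ q.lTensor C).lTensor V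
          (TensorProduct.assoc R V C C (p.rTensor C s))) := by
    intro s
    induction s with
    | zero => simp
    | add a b ha hb => simp only [map_add, ha, hb]
    | tmul a c =>
      have h0 : ∀ t : K ⊗[R] Y,
          (p.rTensor K).rTensor Y ((TensorProduct.assoc R V K Y).symm (a ⊗ₜ t)) =
          (TensorProduct.assoc R (V ⊗[R] C) K Y).symm (p a ⊗ₜ t) := by
        intro t
        induction t with
        | zero => simp
        | add a b ha hb => simp only [tmul_add, map_add, ha, hb]
        | tmul e y => simp
      rw [LinearMap.lTensor_tmul, LinearMap.rTensor_tmul, h0]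
      induction p a with
      | zero => simp
      | add a b ha hb => simp only [add_tmul, map_add, ha, hb]
      | tmul d d' =>
        simp only [LinearMap.lTensor_tmul, LinearMap.comp_apply, assoc_tmul, LinearEquiv.coe_coe]
        induction q c with
        | zero => simp
        | add a b ha hb => simp only [tmul_add, map_add, ha, hb]
        | tmul e y => simp
  have h2 : ∀ s : V ⊗[R] C,
      (l.lTensor V).rTensor Y ((TensorProduct.assoc R V K Y).symm (q.lTensor V s)) =
      (TensorProduct.assoc R V (C ⊗[R] K) Y).symm
        (((TensorProduct.assoc R C K Y).symm.toLinearMap ∘ₗ q.lTensor C).lTensor V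
          ((Coalgebra.comul (R := R) (A := C)).lTensor V s)) := by
    intro s
    induction s with
    | zero => simp
    | add a b ha hb => simp only [map_add, ha, hb]
    | tmul a c =>
      simp only [LinearMap.lTensor_tmul, LinearMap.comp_apply, LinearEquiv.coe_coe]
      rw [← hl]
      induction q c with
      | zero => simp
      | add a b ha hb => simp only [tmul_add, map_add, ha, hb]
      | tmul e y => simp
  rw [h1, h2, hv]

theorem deltaMap_cotensor (M : RComod R C) (t : h.obj M) :
    deltaMap adj M t ∈ cotensor M (cohomSelf C adj).toLComod := by
  refine mem_cotensor.2 ?_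
  suffices H : (TensorProduct.assoc R M.carrier C (h.obj (Bicomod.self R C).toRComod)).toLinearMap ∘ₗ
      M.rcoact.rTensor (h.obj (Bicomod.self R C).toRComod) ∘ₗ deltaMap adj M =
      (lcoactMap adj (Bicomod.self R C)).lTensor M.carrier ∘ₗ deltaMap adj M from
    LinearMap.congr_fun H t
  refine cohom_ext adj fun m => ?_
  simp only [LinearMap.rTensor_comp, LinearMap.comp_apply, deltaMap_eta]
  exact deltaMap_cotensor_aux M.rcoact (eta adj (Bicomod.self R C).toRComod)
    (lcoactMap adj (Bicomod.self R C)) (lcoactMap_eta adj (Bicomod.self R C)) m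
    (LinearMap.congr_fun M.rcoassoc m)

/-- The canonical map `δ_M : h(M) → M □_C h(C)`. -/
def delta (M : RComod R C) : h.obj M →ₗ[R] cotensor M (cohomSelf C adj).toLComod :=
  (deltaMap adj M).codRestrict _ (deltaMap_cotensor adj M)

/-- The unit `η_M` with values in `h(M) □_{e_C(X)} X`. -/
def etaCotensor (M : RComod R C) :
    M.carrier →ₗ[R] cotensor (cohomRComod adj M) (coendBicomod adj).toLComod :=
  (eta adj M).codRestrict _ fun m => by
    refine mem_cotensor.2 ?_
    have h1 := congrArg (TensorProduct.assoc R (h.obj M) (h.obj X) X.carrier)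
      (coactMap_eta adj M m)
    rw [LinearEquiv.apply_symm_apply] at h1
    exact h1

end Cohom

/-! ## Morita-Takeuchi contexts -/

section Context

variable {R D C : Type u} [CommRing R] [AddCommGroup D] [Module R D] [Coalgebra R D]
  [AddCommGroup C] [Module R C] [Coalgebra R C]

/-- A submodule `P` of `V` is pure if `P ⊗ W → V ⊗ W` is injective for every module `W`. -/
def IsPure {V : Type u} [AddCommGroup V] [Module R V] (P : Submodule R V) : Prop :=
  ∀ (W : Type u) [AddCommGroup W] [Module R W], Function.Injective (P.subtype.rTensor W)

/-- A linear map `f : D → M □_C N`, for bicomodules `M` (over `D`, `C`) and `N` (over `C`, `D`), is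
a morphism of `D`-`D`-bicomodules. Here `M □_C N` is a subbicomodule of `M ⊗ N`, on which `D`
coacts from the left through `M` and from the right through `N`, so that colinearity is tested
after the inclusion into `M ⊗ N`. -/
structure IsBicolinear (M : Bicomod R D C) (N : Bicomod R C D)
    (f : D →ₗ[R] cotensor M.toRComod N.toLComod) : Prop where
  left : (cotensor M.toRComod N.toLComod).subtype ∘ₗ f ∈
    LComod.colinear (Bicomod.self R D).toLComod (LComod.tensorObj M.toLComod N.carrier)
  right : (cotensor M.toRComod N.toLComod).subtype ∘ₗ f ∈
    RComod.colinear (Bicomod.self R D).toRComod (RComod.tensorObj M.carrier N.toRComod)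

/-- `(D, C, M, N, f, g)` is a Morita-Takeuchi context. The two diagrams are written in the modules
`M ⊗ N ⊗ M` and `N ⊗ M ⊗ N`, which by flatness and purity contain the threefold cotensor
products; the isomorphisms `M ≅ M □_C C`, `M ≅ D □_D M` are the coactions. -/
structure IsContext (M : Bicomod R D C) (N : Bicomod R C D)
    (f : D →ₗ[R] cotensor M.toRComod N.toLComod)
    (g : C →ₗ[R] cotensor N.toRComod M.toLComod) : Prop where
  flat_left : Module.Flat R D
  flat_right : Module.Flat R C
  bicolinear_f : IsBicolinear M N f
  bicolinear_g : IsBicolinear N M g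
  flat_M : Module.Flat R M.carrier
  flat_N : Module.Flat R N.carrier
  pure_MN : IsPure (cotensor M.toRComod N.toLComod)
  pure_NM : IsPure (cotensor N.toRComod M.toLComod)
  diagram_M :
    ((cotensor N.toRComod M.toLComod).subtype ∘ₗ g).lTensor M.carrier ∘ₗ M.rcoact =
    TensorProduct.assoc R M.carrier N.carrier M.carrier ∘ₗ
      ((cotensor M.toRComod N.toLComod).subtype ∘ₗ f).rTensor M.carrier ∘ₗ M.lcoact
  diagram_N :
    ((cotensor M.toRComod N.toLComod).subtype ∘ₗ f).lTensor N.carrier ∘ₗ N.rcoact =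
    TensorProduct.assoc R N.carrier M.carrier N.carrier ∘ₗ
      ((cotensor N.toRComod M.toLComod).subtype ∘ₗ g).rTensor N.carrier ∘ₗ N.lcoact

/-- `(D, C, M, N, f, g)` is a strict Morita-Takeuchi context: `f` and `g` are bijective. -/
structure IsStrictContext (M : Bicomod R D C) (N : Bicomod R C D)
    (f : D →ₗ[R] cotensor M.toRComod N.toLComod)
    (g : C →ₗ[R] cotensor N.toRComod M.toLComod) : Prop extends IsContext M N f g where
  bijective_f : Function.Bijective f
  bijective_g : Function.Bijective g

end Context

end MoritaTakeuchi

end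

/-!
Since `X` is an injector, maps into the comodules `I ⊗ X` with `I` injective can be extended along
exact sequences, and by adjunction this makes `h` exact. As `h` also commutes with `W ⊗ -`, it
preserves the kernels that define cotensor products: `h(P □ M) ≅ P □ h(M)`. For `M ≅ M □_C C` this
says that `δ_M : h(M) → M □_C h(C)` is an isomorphism, and for `P □_E X` it says that the counit
`h(P □_E X) → P □_E E ≅ P` is one.

After applying `X □_C -`, the unit `η_C` becomes `δ_X ⊗ id` composed with the coaction of `E` on
`X`, and both are injective; faithful coflatness then makes `η_C` (even `η_C ⊗ W`) injective, hence
every `η_M`. So `h` is faithful and reflects epimorphisms. It sends the corestriction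
`M → h(M) □_E X` of `η_M` to a section of an isomorphism, so this corestriction is bijective.
-/

namespace MoritaTakeuchi

noncomputable section

section TensorProduct

variable {R : Type*} [CommRing R] {A A' B B' D D' : Type*} [AddCommGroup A] [Module R A]
  [AddCommGroup A'] [Module R A'] [AddCommGroup B] [Module R B] [AddCommGroup B'] [Module R B']
  [AddCommGroup D] [Module R D] [AddCommGroup D'] [Module R D']

theorem rTensor_lTensor_apply (f : A →ₗ[R] A') (g : B →ₗ[R] B') (t : A ⊗[R] B) :
    f.rTensor B' (g.lTensor A t) = g.lTensor A' (f.rTensor B t) := by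
  rw [← LinearMap.comp_apply, ← LinearMap.comp_apply, LinearMap.rTensor_comp_lTensor,
    LinearMap.lTensor_comp_rTensor]

theorem assoc_rTensor_rTensor (f : A →ₗ[R] A') (t : (A ⊗[R] B) ⊗[R] D) :
    TensorProduct.assoc R A' B D ((f.rTensor B).rTensor D t) =
      f.rTensor (B ⊗[R] D) (TensorProduct.assoc R A B D t) := by
  have h : (TensorProduct.assoc R A' B D).toLinearMap ∘ₗ (f.rTensor B).rTensor D =
      f.rTensor (B ⊗[R] D) ∘ₗ (TensorProduct.assoc R A B D).toLinearMap := by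
    ext; simp
  exact LinearMap.congr_fun h t

theorem assoc_lTensor_rTensor (f : B →ₗ[R] B') (t : (A ⊗[R] B) ⊗[R] D) :
    TensorProduct.assoc R A B' D ((f.lTensor A).rTensor D t) =
      (f.rTensor D).lTensor A (TensorProduct.assoc R A B D t) := by
  have h : (TensorProduct.assoc R A B' D).toLinearMap ∘ₗ (f.lTensor A).rTensor D =
      (f.rTensor D).lTensor A ∘ₗ (TensorProduct.assoc R A B D).toLinearMap := by
    ext; simp
  exact LinearMap.congr_fun h t

theorem assoc_lTensor (f : D →ₗ[R] D') (t : (A ⊗[R] B) ⊗[R] D) :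
    TensorProduct.assoc R A B D' (f.lTensor (A ⊗[R] B) t) =
      (f.lTensor B).lTensor A (TensorProduct.assoc R A B D t) := by
  have h : (TensorProduct.assoc R A B D').toLinearMap ∘ₗ f.lTensor (A ⊗[R] B) =
      (f.lTensor B).lTensor A ∘ₗ (TensorProduct.assoc R A B D).toLinearMap := by
    ext; simp
  exact LinearMap.congr_fun h t

theorem rTensor_rTensor_assoc_symm (f : A →ₗ[R] A') (t : A ⊗[R] (B ⊗[R] D)) :
    (f.rTensor B).rTensor D ((TensorProduct.assoc R A B D).symm t) =
      (TensorProduct.assoc R A' B D).symm (f.rTensor (B ⊗[R] D) t) := by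
  rw [LinearEquiv.eq_symm_apply, assoc_rTensor_rTensor, LinearEquiv.apply_symm_apply]

theorem lTensor_rTensor_assoc_symm (f : B →ₗ[R] B') (t : A ⊗[R] (B ⊗[R] D)) :
    (f.lTensor A).rTensor D ((TensorProduct.assoc R A B D).symm t) =
      (TensorProduct.assoc R A B' D).symm ((f.rTensor D).lTensor A t) := by
  rw [LinearEquiv.eq_symm_apply, assoc_lTensor_rTensor, LinearEquiv.apply_symm_apply]

theorem lTensor_assoc_symm (f : D →ₗ[R] D') (t : A ⊗[R] (B ⊗[R] D)) :
    f.lTensor (A ⊗[R] B) ((TensorProduct.assoc R A B D).symm t) =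
      (TensorProduct.assoc R A B D').symm ((f.lTensor B).lTensor A t) := by
  rw [LinearEquiv.eq_symm_apply, assoc_lTensor, LinearEquiv.apply_symm_apply]

theorem assoc_assoc (t : ((A ⊗[R] B) ⊗[R] D) ⊗[R] D') :
    TensorProduct.assoc R A B (D ⊗[R] D') (TensorProduct.assoc R (A ⊗[R] B) D D' t) =
      (TensorProduct.assoc R B D D').toLinearMap.lTensor A (TensorProduct.assoc R A (B ⊗[R] D) D'
        ((TensorProduct.assoc R A B D).toLinearMap.rTensor D' t)) := by
  have h : (TensorProduct.assoc R A B (D ⊗[R] D')).toLinearMap ∘ₗ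
      (TensorProduct.assoc R (A ⊗[R] B) D D').toLinearMap =
      (TensorProduct.assoc R B D D').toLinearMap.lTensor A ∘ₗ
        (TensorProduct.assoc R A (B ⊗[R] D) D').toLinearMap ∘ₗ
          (TensorProduct.assoc R A B D).toLinearMap.rTensor D' := by
    ext; simp
  exact LinearMap.congr_fun h t

theorem assoc_rTensor_assoc_symm_assoc_symm (t : A ⊗[R] (B ⊗[R] (D ⊗[R] D'))) :
    (TensorProduct.assoc R A B D).toLinearMap.rTensor D'
        ((TensorProduct.assoc R (A ⊗[R] B) D D').symm
          ((TensorProduct.assoc R A B (D ⊗[R] D')).symm t)) =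
      (TensorProduct.assoc R A (B ⊗[R] D) D').symm
        ((TensorProduct.assoc R B D D').symm.toLinearMap.lTensor A t) := by
  have h : (TensorProduct.assoc R A B D).toLinearMap.rTensor D' ∘ₗ
      (TensorProduct.assoc R (A ⊗[R] B) D D').symm.toLinearMap ∘ₗ
        (TensorProduct.assoc R A B (D ⊗[R] D')).symm.toLinearMap =
      (TensorProduct.assoc R A (B ⊗[R] D) D').symm.toLinearMap ∘ₗ
        (TensorProduct.assoc R B D D').symm.toLinearMap.lTensor A := by
    ext; simp
  exact LinearMap.congr_fun h t

theorem mk_rTensor (a : A) (t : B ⊗[R] D) :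
    (TensorProduct.mk R A B a).rTensor D t = (TensorProduct.assoc R A B D).symm (a ⊗ₜ t) := by
  have h : (TensorProduct.mk R A B a).rTensor D =
      (TensorProduct.assoc R A B D).symm.toLinearMap ∘ₗ TensorProduct.mk R A (B ⊗[R] D) a := by
    ext; simp
  exact LinearMap.congr_fun h t

theorem lTensor_rid_assoc (t : (A ⊗[R] B) ⊗[R] R) :
    (TensorProduct.rid R B).toLinearMap.lTensor A (TensorProduct.assoc R A B R t) =
      TensorProduct.rid R (A ⊗[R] B) t := by
  have h : (TensorProduct.rid R B).toLinearMap.lTensor A ∘ₗ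
      (TensorProduct.assoc R A B R).toLinearMap =
        (TensorProduct.rid R (A ⊗[R] B)).toLinearMap := by
    ext; simp
  exact LinearMap.congr_fun h t

theorem rid_rTensor (f : A →ₗ[R] A') (t : A ⊗[R] R) :
    TensorProduct.rid R A' (f.rTensor R t) = f (TensorProduct.rid R A t) := by
  have h : (TensorProduct.rid R A').toLinearMap ∘ₗ f.rTensor R =
      f ∘ₗ (TensorProduct.rid R A).toLinearMap := by
    ext; simp
  exact LinearMap.congr_fun h t

theorem range_eq_ker_sub_of_split {i : A →ₗ[R] B} {a b : B →ₗ[R] D} {s : B →ₗ[R] A}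
    {t : D →ₗ[R] B} (hab : ∀ x, a (i x) = b (i x)) (hb : ∀ y, t (b y) = y)
    (ha : ∀ y, t (a y) = i (s y)) : LinearMap.range i = LinearMap.ker (a - b) := by
  refine le_antisymm ?_ fun y hy => ⟨s y, ?_⟩
  · rintro _ ⟨x, rfl⟩
    simp [hab]
  · rw [← ha, sub_eq_zero.1 (LinearMap.mem_ker.1 hy), hb]

theorem bijective_codRestrict {f : A →ₗ[R] B} {P : Submodule R B} (hfP : ∀ x, f x ∈ P)
    (hf : Function.Injective f) (hrange : LinearMap.range f = P) :
    Function.Bijective (f.codRestrict P hfP) := by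
  refine ⟨(LinearMap.injective_codRestrict_iff hfP).2 hf, fun y => ?_⟩
  obtain ⟨x, hx⟩ : y.1 ∈ LinearMap.range f := hrange.ge y.2
  exact ⟨x, Subtype.ext hx⟩

end TensorProduct

section Counit

variable {R C : Type*} [CommRing R] [AddCommGroup C] [Module R C] [Coalgebra R C]

theorem rid_lTensor_counit_comul (c : C) :
    TensorProduct.rid R C ((Coalgebra.counit (R := R) (A := C)).lTensor C
      (Coalgebra.comul (R := R) c)) = c := by
  simp

theorem lTensor_lid_counit_assoc_comul {W : Type*} [AddCommGroup W] [Module R W] (t : C ⊗[R] W) :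
    ((TensorProduct.lid R W).toLinearMap ∘ₗ (Coalgebra.counit (R := R) (A := C)).rTensor W).lTensor
      C (TensorProduct.assoc R C C W ((Coalgebra.comul (R := R) (A := C)).rTensor W t)) = t := by
  rw [LinearMap.lTensor_comp_apply, ← assoc_lTensor_rTensor, ← LinearMap.rTensor_comp_apply,
    Coalgebra.lTensor_counit_comp_comul]
  induction t with
  | zero => simp
  | add a b ha hb => simp only [map_add, ha, hb]
  | tmul c w => simp

end Counit

section Comodules

variable {R C : Type u} [CommRing R] [AddCommGroup C] [Module R C] [Coalgebra R C]

theorem RComod.rid_counit_rcoact (M : RComod R C) (m : M.carrier) :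
    TensorProduct.rid R M.carrier
      ((Coalgebra.counit (R := R) (A := C)).lTensor M.carrier (M.rcoact m)) = m := by
  rw [← LinearMap.comp_apply _ M.rcoact, M.rcounit]
  simp

theorem LComod.lid_counit_lcoact (M : LComod R C) (m : M.carrier) :
    TensorProduct.lid R M.carrier
      ((Coalgebra.counit (R := R) (A := C)).rTensor M.carrier (M.lcoact m)) = m := by
  rw [← LinearMap.comp_apply _ M.lcoact, M.lcounit]
  simp

theorem RComod.coassoc_apply (M : RComod R C) (m : M.carrier) :
    TensorProduct.assoc R M.carrier C C (M.rcoact.rTensor C (M.rcoact m)) =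
      (Coalgebra.comul (R := R) (A := C)).lTensor M.carrier (M.rcoact m) :=
  LinearMap.congr_fun M.rcoassoc m

theorem LComod.coassoc_apply (M : LComod R C) (m : M.carrier) :
    TensorProduct.assoc R C C M.carrier
        ((Coalgebra.comul (R := R) (A := C)).rTensor M.carrier (M.lcoact m)) =
      M.lcoact.lTensor C (M.lcoact m) :=
  LinearMap.congr_fun M.lcoassoc m

theorem RComod.rcoact_hom_apply {M N : RComod R C} (f : M ⟶ N) (m : M.carrier) :
    N.rcoact (RComod.lin f m) = (RComod.lin f).rTensor C (M.rcoact m) :=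
  LinearMap.congr_fun (RComod.mem_colinear.1 f.2) m

theorem LComod.lcoact_hom_apply {M N : LComod R C} (f : M ⟶ N) (m : M.carrier) :
    N.lcoact (LComod.lin f m) = (LComod.lin f).lTensor C (M.lcoact m) :=
  LinearMap.congr_fun (LComod.mem_colinear.1 f.2) m

theorem RComod.rcoact_injective (M : RComod R C) : Function.Injective M.rcoact :=
  Function.LeftInverse.injective (g := fun t => TensorProduct.rid R M.carrier
    ((Coalgebra.counit (R := R) (A := C)).lTensor M.carrier t)) M.rid_counit_rcoact

theorem RComod.rcoact_lTensor_injective (M : RComod R C) (W : Type*) [AddCommGroup W]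
    [Module R W] : Function.Injective (M.rcoact.lTensor W) := by
  let r := (TensorProduct.rid R M.carrier).toLinearMap ∘ₗ
    (Coalgebra.counit (R := R) (A := C)).lTensor M.carrier
  have hr : r ∘ₗ M.rcoact = LinearMap.id := LinearMap.ext M.rid_counit_rcoact
  refine Function.LeftInverse.injective (g := r.lTensor W) fun x => ?_
  rw [← LinearMap.lTensor_comp_apply, hr, LinearMap.lTensor_id_apply]

theorem LComod.lcoact_rTensor_injective (M : LComod R C) (W : Type*) [AddCommGroup W]
    [Module R W] : Function.Injective (M.lcoact.rTensor W) := by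
  let r := (TensorProduct.lid R M.carrier).toLinearMap ∘ₗ
    (Coalgebra.counit (R := R) (A := C)).rTensor M.carrier
  have hr : r ∘ₗ M.lcoact = LinearMap.id := LinearMap.ext M.lid_counit_lcoact
  refine Function.LeftInverse.injective (g := r.rTensor W) fun x => ?_
  rw [← LinearMap.rTensor_comp_apply, hr, LinearMap.rTensor_id_apply]

theorem RComod.mono_of_injective {M N : RComod R C} (f : M ⟶ N)
    (hf : Function.Injective (RComod.lin f)) : Mono f :=
  ⟨fun _ _ hab => Subtype.ext (LinearMap.ext fun x => hf (LinearMap.congr_fun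
    (congrArg RComod.lin hab) x))⟩

theorem RComod.nonempty_iso_of_bijective {M N : RComod R C} (f : M ⟶ N)
    (hf : Function.Bijective (RComod.lin f)) : Nonempty (M ≅ N) := by
  let e := LinearEquiv.ofBijective (RComod.lin f) hf
  have he : e.symm.toLinearMap ∈ RComod.colinear N M := by
    refine RComod.mem_colinear.2 (LinearMap.ext fun y => ?_)
    obtain ⟨x, rfl⟩ := hf.2 y
    have hsymm : e.symm.toLinearMap ∘ₗ RComod.lin f = LinearMap.id := by
      ext z
      exact e.symm_apply_apply z
    rw [LinearMap.comp_apply, LinearMap.comp_apply, RComod.rcoact_hom_apply,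
      ← LinearMap.rTensor_comp_apply, hsymm, LinearMap.rTensor_id_apply]
    exact congrArg M.rcoact (LinearMap.congr_fun hsymm x)
  exact ⟨⟨f, ⟨_, he⟩, Subtype.ext (LinearMap.ext e.symm_apply_apply),
    Subtype.ext (LinearMap.ext e.apply_symm_apply)⟩⟩

theorem LComod.rTensor_mem {M N : LComod R C} {f : M.carrier →ₗ[R] N.carrier}
    (hf : f ∈ LComod.colinear M N) (W : Type u) [AddCommGroup W] [Module R W] :
    f.rTensor W ∈ LComod.colinear (LComod.tensorObj M W) (LComod.tensorObj N W) := by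
  rw [LComod.mem_colinear]
  refine LinearMap.ext fun x => ?_
  simp only [LinearMap.comp_apply, LinearEquiv.coe_coe]
  rw [← assoc_lTensor_rTensor, ← LinearMap.rTensor_comp_apply, ← LinearMap.rTensor_comp_apply,
    LComod.mem_colinear.1 hf]

theorem LComod.lTensor_mem {W V : Type u} [AddCommGroup W] [Module R W] [AddCommGroup V]
    [Module R V] (f : W →ₗ[R] V) (M : LComod R C) :
    f.lTensor M.carrier ∈ LComod.colinear (LComod.tensorObj M W) (LComod.tensorObj M V) := by
  rw [LComod.mem_colinear]
  refine LinearMap.ext fun x => ?_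
  simp only [LinearMap.comp_apply, LinearEquiv.coe_coe]
  rw [← assoc_lTensor, rTensor_lTensor_apply]

theorem range_rcoact (M : RComod R C) :
    LinearMap.range M.rcoact = cotensor M (Bicomod.self R C).toLComod := by
  let ε := Coalgebra.counit (R := R) (A := C)
  refine range_eq_ker_sub_of_split
    (t := ((TensorProduct.rid R C).toLinearMap ∘ₗ ε.lTensor C).lTensor M.carrier)
    (s := (TensorProduct.rid R M.carrier).toLinearMap ∘ₗ ε.lTensor M.carrier)
    M.coassoc_apply (fun y => ?_) fun y => ?_
  · rw [← LinearMap.lTensor_comp_apply]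
    exact (congrArg (fun g : C →ₗ[R] C => g.lTensor M.carrier y)
      (LinearMap.ext rid_lTensor_counit_comul)).trans (LinearMap.lTensor_id_apply _ _ y)
  · simp only [LinearMap.comp_apply, LinearEquiv.coe_coe, LinearMap.lTensor_comp_apply]
    rw [← assoc_lTensor, lTensor_rid_assoc, ← rTensor_lTensor_apply, rid_rTensor]

theorem range_assoc_rcoact_rTensor (X : RComod R C) (W : Type u) [AddCommGroup W] [Module R W] :
    LinearMap.range ((TensorProduct.assoc R X.carrier C W).toLinearMap ∘ₗ X.rcoact.rTensor W) =
      cotensor X (LComod.tensorObj (Bicomod.self R C).toLComod W) := by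
  let e := (TensorProduct.lid R W).toLinearMap ∘ₗ
    (Coalgebra.counit (R := R) (A := C)).rTensor W
  refine range_eq_ker_sub_of_split (t := (e.lTensor C).lTensor X.carrier)
    (s := e.lTensor X.carrier) (fun x => ?_) (fun y => ?_) fun y => ?_
  · simp only [LinearMap.comp_apply, LinearEquiv.coe_coe, LinearMap.lTensor_comp_apply]
    rw [← assoc_rTensor_rTensor, assoc_assoc, ← LinearMap.rTensor_comp_apply,
      ← LinearMap.rTensor_comp_apply, LinearMap.comp_assoc, X.rcoassoc,
      LinearMap.rTensor_comp_apply, assoc_lTensor_rTensor]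
  · rw [← LinearMap.lTensor_comp_apply]
    exact (congrArg (fun g : C ⊗[R] W →ₗ[R] C ⊗[R] W => g.lTensor X.carrier y)
      (LinearMap.ext lTensor_lid_counit_assoc_comul)).trans (LinearMap.lTensor_id_apply _ _ y)
  · simp only [LinearMap.comp_apply, LinearEquiv.coe_coe]
    rw [← assoc_lTensor, ← rTensor_lTensor_apply]

end Comodules

section Kernels

variable {R C : Type u} [CommRing R] [AddCommGroup C] [Module R C] [Coalgebra R C]
  [Module.Flat R C]

/-- The coaction of a flat coalgebra `C` on the kernel of a morphism of right `C`-comodules: the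
restriction of the ambient coaction, which lands in the submodule `ker g ⊗ C` of `N ⊗ C`. -/
def RComod.kerCoact {N P : RComod R C} (g : N ⟶ P) :
    LinearMap.ker (RComod.lin g) →ₗ[R] LinearMap.ker (RComod.lin g) ⊗[R] C :=
  (N.rcoact ∘ₗ (LinearMap.ker (RComod.lin g)).subtype).codRestrictOfInjective
    ((LinearMap.ker (RComod.lin g)).subtype.rTensor C)
    (Module.Flat.rTensor_preserves_injective_linearMap _ (Submodule.injective_subtype _))
    fun x => (Module.Flat.rTensor_exact C (LinearMap.exact_subtype_ker_map (RComod.lin g)) _).1 <|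
      by rw [LinearMap.comp_apply, Submodule.subtype_apply, ← RComod.rcoact_hom_apply,
        LinearMap.mem_ker.1 x.2, map_zero]

theorem RComod.rTensor_comp_kerCoact {N P : RComod R C} (g : N ⟶ P) :
    (LinearMap.ker (RComod.lin g)).subtype.rTensor C ∘ₗ RComod.kerCoact g =
      N.rcoact ∘ₗ (LinearMap.ker (RComod.lin g)).subtype :=
  LinearMap.codRestrictOfInjective_comp ..

theorem RComod.rTensor_kerCoact {N P : RComod R C} (g : N ⟶ P)
    (x : LinearMap.ker (RComod.lin g)) :
    (LinearMap.ker (RComod.lin g)).subtype.rTensor C (RComod.kerCoact g x) = N.rcoact x.1 :=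
  LinearMap.congr_fun (RComod.rTensor_comp_kerCoact g) x

/-- The kernel of a morphism of right comodules over a flat coalgebra. -/
def RComod.ker {N P : RComod R C} (g : N ⟶ P) : RComod R C where
  carrier := LinearMap.ker (RComod.lin g)
  rcoact := RComod.kerCoact g
  rcoassoc := by
    refine LinearMap.ext fun x => Module.Flat.rTensor_preserves_injective_linearMap
      (M := C ⊗[R] C) _ (Submodule.injective_subtype _) ?_
    simp only [LinearMap.comp_apply, LinearEquiv.coe_coe]
    rw [← assoc_rTensor_rTensor, ← LinearMap.rTensor_comp_apply, RComod.rTensor_comp_kerCoact,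
      LinearMap.rTensor_comp_apply, RComod.rTensor_kerCoact, rTensor_lTensor_apply,
      RComod.rTensor_kerCoact, RComod.coassoc_apply]
  rcounit := by
    refine LinearMap.ext fun x => Module.Flat.rTensor_preserves_injective_linearMap
      (M := R) _ (Submodule.injective_subtype _) ?_
    rw [LinearMap.comp_apply, rTensor_lTensor_apply, RComod.rTensor_kerCoact]
    exact LinearMap.congr_fun N.rcounit x.1

/-- The inclusion of the kernel of a morphism of right comodules. -/
def RComod.kerι {N P : RComod R C} (g : N ⟶ P) : RComod.ker g ⟶ N :=
  ⟨(LinearMap.ker (RComod.lin g)).subtype, (RComod.rTensor_comp_kerCoact g).symm⟩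

theorem RComod.kerι_injective {N P : RComod R C} (g : N ⟶ P) :
    Function.Injective (RComod.lin (RComod.kerι g)) :=
  Submodule.injective_subtype _

theorem RComod.range_kerι {N P : RComod R C} (g : N ⟶ P) :
    LinearMap.range (RComod.lin (RComod.kerι g)) = LinearMap.ker (RComod.lin g) :=
  Submodule.range_subtype _

/-- The coaction of a flat coalgebra `C` on the kernel of a morphism of left `C`-comodules. -/
def LComod.kerCoact {N P : LComod R C} (g : N ⟶ P) :
    LinearMap.ker (LComod.lin g) →ₗ[R] C ⊗[R] LinearMap.ker (LComod.lin g) :=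
  (N.lcoact ∘ₗ (LinearMap.ker (LComod.lin g)).subtype).codRestrictOfInjective
    ((LinearMap.ker (LComod.lin g)).subtype.lTensor C)
    (Module.Flat.lTensor_preserves_injective_linearMap _ (Submodule.injective_subtype _))
    fun x => (Module.Flat.lTensor_exact C (LinearMap.exact_subtype_ker_map (LComod.lin g)) _).1 <|
      by rw [LinearMap.comp_apply, Submodule.subtype_apply, ← LComod.lcoact_hom_apply,
        LinearMap.mem_ker.1 x.2, map_zero]

theorem LComod.lTensor_comp_kerCoact {N P : LComod R C} (g : N ⟶ P) :
    (LinearMap.ker (LComod.lin g)).subtype.lTensor C ∘ₗ LComod.kerCoact g =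
      N.lcoact ∘ₗ (LinearMap.ker (LComod.lin g)).subtype :=
  LinearMap.codRestrictOfInjective_comp ..

theorem LComod.lTensor_kerCoact {N P : LComod R C} (g : N ⟶ P)
    (x : LinearMap.ker (LComod.lin g)) :
    (LinearMap.ker (LComod.lin g)).subtype.lTensor C (LComod.kerCoact g x) = N.lcoact x.1 :=
  LinearMap.congr_fun (LComod.lTensor_comp_kerCoact g) x

/-- The kernel of a morphism of left comodules over a flat coalgebra. -/
def LComod.ker {N P : LComod R C} (g : N ⟶ P) : LComod R C where
  carrier := LinearMap.ker (LComod.lin g)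
  lcoact := LComod.kerCoact g
  lcoassoc := by
    refine LinearMap.ext fun x => Module.Flat.lTensor_preserves_injective_linearMap
      (M := C) _ (Module.Flat.lTensor_preserves_injective_linearMap (M := C) _
        (Submodule.injective_subtype _)) ?_
    simp only [LinearMap.comp_apply, LinearEquiv.coe_coe]
    rw [← assoc_lTensor, ← rTensor_lTensor_apply, LComod.lTensor_kerCoact,
      ← LinearMap.lTensor_comp_apply, LComod.lTensor_comp_kerCoact,
      LinearMap.lTensor_comp_apply, LComod.lTensor_kerCoact, LComod.coassoc_apply]
  lcounit := by
    refine LinearMap.ext fun x => Module.Flat.lTensor_preserves_injective_linearMap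
      (M := R) _ (Submodule.injective_subtype _) ?_
    rw [LinearMap.comp_apply, ← rTensor_lTensor_apply, LComod.lTensor_kerCoact]
    exact LinearMap.congr_fun N.lcounit x.1

/-- The inclusion of the kernel of a morphism of left comodules. -/
def LComod.kerι {N P : LComod R C} (g : N ⟶ P) : LComod.ker g ⟶ N :=
  ⟨(LinearMap.ker (LComod.lin g)).subtype, (LComod.lTensor_comp_kerCoact g).symm⟩

theorem LComod.injective_of_mono {N P : LComod R C} (f : N ⟶ P) [Mono f] :
    Function.Injective (LComod.lin f) := by
  let z : LComod.ker f ⟶ N := ⟨0, Submodule.zero_mem _⟩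
  have hz : LComod.kerι f ≫ f = z ≫ f :=
    Subtype.ext (LinearMap.ext fun x =>
      (LinearMap.mem_ker.1 x.2).trans (map_zero (LComod.lin f)).symm)
  have hι : (LinearMap.ker (LComod.lin f)).subtype = 0 :=
    congrArg LComod.lin ((cancel_mono f).1 hz)
  exact LinearMap.ker_eq_bot.1 ((Submodule.range_subtype _).symm.trans (by rw [hι]; simp))

theorem RComod.exists_lift {K N T : RComod R C} (i : K ⟶ N)
    (hi : Function.Injective (RComod.lin i)) (s : T ⟶ N)
    (hs : LinearMap.range (RComod.lin s) ≤ LinearMap.range (RComod.lin i)) :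
    ∃ f : T ⟶ K, f ≫ i = s := by
  let f := (RComod.lin s).codRestrictOfInjective (RComod.lin i) hi fun x => hs ⟨x, rfl⟩
  have hf : RComod.lin i ∘ₗ f = RComod.lin s := LinearMap.codRestrictOfInjective_comp ..
  have hf_apply : ∀ x, RComod.lin i (f x) = RComod.lin s x := LinearMap.congr_fun hf
  refine ⟨⟨f, RComod.mem_colinear.2 (LinearMap.ext fun x =>
    Module.Flat.rTensor_preserves_injective_linearMap (M := C) _ hi ?_)⟩, Subtype.ext hf⟩
  rw [LinearMap.comp_apply, LinearMap.comp_apply, ← RComod.rcoact_hom_apply, hf_apply,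
    ← LinearMap.rTensor_comp_apply, hf, RComod.rcoact_hom_apply]

end Kernels

section Cokernels

variable {R C : Type u} [CommRing R] [AddCommGroup C] [Module R C] [Coalgebra R C]

/-- The coaction induced on the cokernel of a morphism of right comodules. -/
def RComod.cokerCoact {M N : RComod R C} (f : M ⟶ N) :
    (N.carrier ⧸ LinearMap.range (RComod.lin f)) →ₗ[R]
      (N.carrier ⧸ LinearMap.range (RComod.lin f)) ⊗[R] C :=
  (LinearMap.range (RComod.lin f)).liftQ
    ((LinearMap.range (RComod.lin f)).mkQ.rTensor C ∘ₗ N.rcoact) (by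
      rintro _ ⟨x, rfl⟩
      rw [LinearMap.mem_ker, LinearMap.comp_apply, RComod.rcoact_hom_apply,
        ← LinearMap.rTensor_comp_apply, LinearMap.range_mkQ_comp, LinearMap.rTensor_zero,
        LinearMap.zero_apply])

theorem RComod.cokerCoact_comp_mkQ {M N : RComod R C} (f : M ⟶ N) :
    RComod.cokerCoact f ∘ₗ (LinearMap.range (RComod.lin f)).mkQ =
      (LinearMap.range (RComod.lin f)).mkQ.rTensor C ∘ₗ N.rcoact :=
  Submodule.liftQ_mkQ ..

theorem RComod.cokerCoact_mkQ {M N : RComod R C} (f : M ⟶ N) (x : N.carrier) :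
    RComod.cokerCoact f ((LinearMap.range (RComod.lin f)).mkQ x) =
      (LinearMap.range (RComod.lin f)).mkQ.rTensor C (N.rcoact x) :=
  LinearMap.congr_fun (RComod.cokerCoact_comp_mkQ f) x

/-- The cokernel of a morphism of right comodules. -/
def RComod.coker {M N : RComod R C} (f : M ⟶ N) : RComod R C where
  carrier := N.carrier ⧸ LinearMap.range (RComod.lin f)
  rcoact := RComod.cokerCoact f
  rcoassoc := by
    refine Submodule.linearMap_qext _ (LinearMap.ext fun x => ?_)
    simp only [LinearMap.comp_apply, LinearEquiv.coe_coe]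
    rw [RComod.cokerCoact_mkQ, ← LinearMap.rTensor_comp_apply, RComod.cokerCoact_comp_mkQ,
      LinearMap.rTensor_comp_apply, assoc_rTensor_rTensor, RComod.coassoc_apply,
      rTensor_lTensor_apply]
  rcounit := by
    refine Submodule.linearMap_qext _ (LinearMap.ext fun x => ?_)
    rw [LinearMap.comp_apply, LinearMap.comp_apply, RComod.cokerCoact_mkQ,
      ← rTensor_lTensor_apply, ← LinearMap.comp_apply _ N.rcoact, N.rcounit]
    simp

/-- The projection onto the cokernel of a morphism of right comodules. -/
def RComod.cokerπ {M N : RComod R C} (f : M ⟶ N) : N ⟶ RComod.coker f :=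
  ⟨(LinearMap.range (RComod.lin f)).mkQ, RComod.cokerCoact_comp_mkQ f⟩

theorem RComod.exists_coker_desc {M N T : RComod R C} (f : M ⟶ N) (s : N ⟶ T) (hs : f ≫ s = 0) :
    ∃ e : RComod.coker f ⟶ T, RComod.cokerπ f ≫ e = s := by
  let e := (LinearMap.range (RComod.lin f)).liftQ (RComod.lin s)
    (LinearMap.range_le_ker_iff.2 (congrArg RComod.lin hs))
  have he : e ∘ₗ (LinearMap.range (RComod.lin f)).mkQ = RComod.lin s := Submodule.liftQ_mkQ ..
  refine ⟨⟨e, RComod.mem_colinear.2 (Submodule.linearMap_qext _ (LinearMap.ext fun x => ?_))⟩,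
    Subtype.ext he⟩
  have hx : e ((LinearMap.range (RComod.lin f)).mkQ x) = RComod.lin s x := LinearMap.congr_fun he x
  refine (congrArg T.rcoact hx).trans
    (Eq.trans ?_ (congrArg (e.rTensor C) (RComod.cokerCoact_mkQ f x)).symm)
  rw [← LinearMap.rTensor_comp_apply, he, RComod.rcoact_hom_apply]

theorem RComod.surjective_of_epi {M N : RComod R C} (f : M ⟶ N) [Epi f] :
    Function.Surjective (RComod.lin f) := by
  have hf : f ≫ RComod.cokerπ f = f ≫ 0 :=
    Subtype.ext ((LinearMap.range_mkQ_comp _).trans (LinearMap.zero_comp (RComod.lin f)).symm)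
  have hπ : (LinearMap.range (RComod.lin f)).mkQ = 0 :=
    congrArg RComod.lin ((cancel_epi f).1 hf)
  rw [← LinearMap.range_eq_top, ← Submodule.ker_mkQ (LinearMap.range (RComod.lin f)), hπ,
    LinearMap.ker_zero]

theorem RComod.exists_extension {M N P T : RComod R C} [Injective T] (f : M ⟶ N) (g : N ⟶ P)
    (hfg : Function.Exact (RComod.lin f) (RComod.lin g)) (s : N ⟶ T) (hs : f ≫ s = 0) :
    ∃ e : P ⟶ T, g ≫ e = s := by
  obtain ⟨g', hg'⟩ := RComod.exists_coker_desc f g (Subtype.ext hfg.linearMap_comp_eq_zero)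
  obtain ⟨s', hs'⟩ := RComod.exists_coker_desc f s hs
  have hinj : Function.Injective (RComod.lin g') := by
    rw [injective_iff_map_eq_zero]
    intro y hy
    obtain ⟨x, rfl⟩ := Submodule.mkQ_surjective (LinearMap.range (RComod.lin f)) y
    have hx : RComod.lin g x = 0 := (LinearMap.congr_fun (congrArg RComod.lin hg') x).symm.trans hy
    exact (Submodule.Quotient.mk_eq_zero _).2 ((hfg x).1 hx)
  have := RComod.mono_of_injective g' hinj
  exact ⟨Injective.factorThru s' g', by
    rw [← hg', Category.assoc, Injective.comp_factorThru, hs']⟩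

end Cokernels

section Coflat

variable {R C : Type u} [CommRing R] [AddCommGroup C] [Module R C] [Coalgebra R C]
  [Module.Flat R C] {X : RComod R C}

theorem IsFaithfullyCoflat.injective_of_cotensor_injective (hX : IsFaithfullyCoflat X)
    {N P : LComod R C} (f : N ⟶ P)
    (hf : Function.Injective ((cotensorFunctor X).map f).hom) :
    Function.Injective (LComod.lin f) := by
  have := hX.2
  have : Mono ((cotensorFunctor X).map f) := (ModuleCat.mono_iff_injective _).2 hf
  have : Mono f := (cotensorFunctor X).mono_of_mono_map this
  exact LComod.injective_of_mono f

theorem IsCoflat.flat (hX : IsCoflat X) : Module.Flat R X.carrier := by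
  rw [Module.Flat.iff_lTensor_preserves_injective_linearMap]
  intro W V _ _ _ _ f hf
  obtain ⟨hcot, -⟩ := hX (N₁ := LComod.tensorObj (Bicomod.self R C).toLComod W)
    (N₂ := LComod.tensorObj (Bicomod.self R C).toLComod V)
    (N₃ := LComod.tensorObj (Bicomod.self R C).toLComod (V ⧸ LinearMap.range f))
    ⟨_, LComod.lTensor_mem f _⟩ ⟨_, LComod.lTensor_mem _ _⟩
    (Module.Flat.lTensor_preserves_injective_linearMap _ hf)
    (Module.Flat.lTensor_exact C (LinearMap.exact_map_mkQ_range f))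
    (LinearMap.lTensor_surjective _ (Submodule.mkQ_surjective _))
  let ρ (W : Type u) [AddCommGroup W] [Module R W] :=
    (TensorProduct.assoc R X.carrier C W).toLinearMap ∘ₗ X.rcoact.rTensor W
  have hρ_inj : Function.Injective (ρ W) := (TensorProduct.assoc R X.carrier C W).injective.comp
    ((LinearMap.lTensor_inj_iff_rTensor_inj _ _).1 (X.rcoact_lTensor_injective W))
  have hρ_nat : ∀ s, (f.lTensor C).lTensor X.carrier (ρ W s) = ρ V (f.lTensor X.carrier s) :=
    fun s => by
      simp only [ρ, LinearMap.comp_apply, LinearEquiv.coe_coe]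
      rw [← assoc_lTensor, ← rTensor_lTensor_apply]
  have hρ_mem : ∀ s, ρ W s ∈ cotensor X (LComod.tensorObj (Bicomod.self R C).toLComod W) :=
    fun s => range_assoc_rcoact_rTensor X W ▸ ⟨s, rfl⟩
  refine fun s t hst => hρ_inj (congrArg Subtype.val
    (@hcot ⟨ρ W s, hρ_mem s⟩ ⟨ρ W t, hρ_mem t⟩ (Subtype.ext ?_)))
  exact (hρ_nat s).trans ((congrArg (ρ V) hst).trans (hρ_nat t).symm)

end Coflat

section CohomFunctor

variable {R C : Type u} [CommRing R] [AddCommGroup C] [Module R C] [Coalgebra R C]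

/-- The morphism `g ⊗ M : W ⊗ M ⟶ V ⊗ M` of right comodules. -/
def RComod.rTensorHom {W V : Type u} [AddCommGroup W] [Module R W] [AddCommGroup V] [Module R V]
    (g : W →ₗ[R] V) (M : RComod R C) : RComod.tensorObj W M ⟶ RComod.tensorObj V M :=
  ⟨g.rTensor M.carrier, RComod.rTensor_mem g M⟩

/-- The morphism `W ⊗ f : W ⊗ M ⟶ W ⊗ N` of right comodules. -/
def RComod.lTensorHom (W : Type u) [AddCommGroup W] [Module R W] {M N : RComod R C} (f : M ⟶ N) :
    RComod.tensorObj W M ⟶ RComod.tensorObj W N :=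
  ⟨(RComod.lin f).lTensor W, RComod.lTensor_mem W f.2⟩

/-- The associativity morphism `W ⊗ (V ⊗ M) ⟶ (W ⊗ V) ⊗ M` of right comodules. -/
def RComod.assocSymmHom (W V : Type u) [AddCommGroup W] [Module R W] [AddCommGroup V] [Module R V]
    (M : RComod R C) :
    RComod.tensorObj W (RComod.tensorObj V M) ⟶ RComod.tensorObj (W ⊗[R] V) M :=
  ⟨_, RComod.assoc_symm_mem W V M⟩

/-- The morphism `w ⊗ - : M ⟶ W ⊗ M` of right comodules, as a linear function of `w`. -/
def RComod.tensorMk (W : Type u) [AddCommGroup W] [Module R W] (M : RComod R C) :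
    W →ₗ[R] (M ⟶ RComod.tensorObj W M) :=
  (TensorProduct.mk R W M.carrier).codRestrict (RComod.colinear M (RComod.tensorObj W M))
    fun w => by
      refine RComod.mem_colinear.2 (LinearMap.ext fun m => ?_)
      exact (mk_rTensor w (M.rcoact m)).symm

variable {X : RComod R C} {h : RComod R C ⥤ ModuleCat.{u} R} (adj : h ⊣ tensorFunctor X)

theorem map_rTensor_eta {M N : RComod R C} (f : M ⟶ N) (m : M.carrier) :
    (h.map f).hom.rTensor X.carrier (eta adj M m) = eta adj N (RComod.lin f m) :=
  (LinearMap.congr_fun (congrArg RComod.lin (adj.unit.naturality f)) m).symm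

instance tensorFunctor_additive : (tensorFunctor X).Additive where
  map_add := Subtype.ext (LinearMap.rTensor_add ..)

include adj in
theorem cohom_linear : h.Linear R where
  map_smul f r := ModuleCat.hom_ext <| cohom_ext adj fun m => by
    rw [map_rTensor_eta, ModuleCat.hom_smul, LinearMap.rTensor_smul, LinearMap.smul_apply,
      map_rTensor_eta, ← map_smul]
    rfl

include adj in
theorem cohom_map_injective (hinj : IsInjector X) {M N : RComod R C} (f : M ⟶ N)
    (hf : Function.Injective (RComod.lin f)) : Function.Injective (h.map f).hom := by
  have : (tensorFunctor X).PreservesInjectiveObjects := hinj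
  have := h.preservesMonomorphisms_of_adjunction_of_preservesInjectiveObjects adj
  have := RComod.mono_of_injective f hf
  exact (ModuleCat.mono_iff_injective _).1 inferInstance

include adj in
theorem cohom_map_exact (hinj : IsInjector X) {M N P : RComod R C} (f : M ⟶ N) (g : N ⟶ P)
    (hfg : Function.Exact (RComod.lin f) (RComod.lin g)) :
    Function.Exact (h.map f).hom (h.map g).hom := by
  have : h.Additive := adj.left_adjoint_additive
  have : (tensorFunctor X).PreservesInjectiveObjects := hinj
  have hzero : h.map f ≫ h.map g = 0 := by
    have hcomp : f ≫ g = 0 := Subtype.ext hfg.linearMap_comp_eq_zero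
    rw [← h.map_comp, hcomp, h.map_zero]
  let q := ModuleCat.ofHom (LinearMap.range (h.map f).hom).mkQ
  let ι := Injective.ι (ModuleCat.of R (h.obj N ⧸ LinearMap.range (h.map f).hom))
  have hq : h.map f ≫ q = 0 := ModuleCat.hom_ext (LinearMap.range_mkQ_comp _)
  have := (tensorFunctor X).injective_obj (Injective.under
    (ModuleCat.of R (h.obj N ⧸ LinearMap.range (h.map f).hom)))
  obtain ⟨e, he⟩ := RComod.exists_extension f g hfg (adj.homEquiv N _ (q ≫ ι)) (by
    rw [← adj.homEquiv_naturality_left, reassoc_of% hq, Limits.zero_comp,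
      adj.homAddEquiv_zero])
  have hfactor : h.map g ≫ (adj.homEquiv P _).symm e = q ≫ ι := by
    rw [← adj.homEquiv_naturality_left_symm, he, Equiv.symm_apply_apply]
  refine fun y => ⟨fun hy => ?_, ?_⟩
  · have hι : Function.Injective ι.hom := (ModuleCat.mono_iff_injective ι).1 inferInstance
    refine (Submodule.Quotient.mk_eq_zero _).1 (hι ?_)
    have hy' := LinearMap.congr_fun (congrArg ModuleCat.Hom.hom hfactor) y
    rw [ModuleCat.hom_comp, LinearMap.comp_apply, hy, map_zero] at hy'
    exact hy'.symm.trans (map_zero _).symm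
  · rintro ⟨x, rfl⟩
    exact LinearMap.congr_fun (congrArg ModuleCat.Hom.hom hzero) x

section TensorComparison

variable (W : Type u) [AddCommGroup W] [Module R W] (M : RComod R C)

theorem assoc_symm_comp_eta_mem :
    (TensorProduct.assoc R W (h.obj M) X.carrier).symm.toLinearMap ∘ₗ (eta adj M).lTensor W ∈
      RComod.colinear (RComod.tensorObj W M) (RComod.tensorObj (W ⊗[R] h.obj M) X) :=
  RComod.comp_mem (N := RComod.tensorObj W (RComod.tensorObj (h.obj M) X))
    (RComod.assoc_symm_mem W (h.obj M) X) (RComod.lTensor_mem W (eta_mem adj M))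

/-- The comparison map `h(W ⊗ M) → W ⊗ h(M)`. -/
def cohomTensor : h.obj (RComod.tensorObj W M) →ₗ[R] W ⊗[R] h.obj M :=
  desc adj _ (assoc_symm_comp_eta_mem adj W M)

theorem cohomTensor_eta (t : W ⊗[R] M.carrier) :
    (cohomTensor adj W M).rTensor X.carrier (eta adj (RComod.tensorObj W M) t) =
      (TensorProduct.assoc R W (h.obj M) X.carrier).symm ((eta adj M).lTensor W t) :=
  desc_apply adj _ (assoc_symm_comp_eta_mem adj W M) t

/-- The inverse of the comparison map, `w ⊗ x ↦ h(w ⊗ -)(x)`. -/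
def cohomTensorInv : W ⊗[R] h.obj M →ₗ[R] h.obj (RComod.tensorObj W M) :=
  have := adj.left_adjoint_additive
  have := cohom_linear adj
  TensorProduct.lift (ModuleCat.homLinearEquiv (S := R).toLinearMap ∘ₗ
    h.mapLinearMap R ∘ₗ RComod.tensorMk W M)

theorem cohomTensorInv_comp_mk (w : W) :
    cohomTensorInv adj W M ∘ₗ TensorProduct.mk R W (h.obj M) w =
      (h.map (RComod.tensorMk W M w)).hom := by
  ext x
  simp [cohomTensorInv, ModuleCat.homLinearEquiv]

theorem cohomTensor_comp_cohomTensorInv :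
    cohomTensor adj W M ∘ₗ cohomTensorInv adj W M = LinearMap.id := by
  refine TensorProduct.ext (LinearMap.ext fun w => cohom_ext adj fun m => ?_)
  change (cohomTensor adj W M ∘ₗ cohomTensorInv adj W M ∘ₗ
    TensorProduct.mk R W (h.obj M) w).rTensor X.carrier _ =
      (TensorProduct.mk R W (h.obj M) w).rTensor X.carrier _
  rw [cohomTensorInv_comp_mk, LinearMap.rTensor_comp_apply, map_rTensor_eta, cohomTensor_eta,
    mk_rTensor]
  rfl

theorem cohomTensorInv_comp_cohomTensor :
    cohomTensorInv adj W M ∘ₗ cohomTensor adj W M = LinearMap.id := by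
  refine cohom_ext adj fun t => ?_
  rw [LinearMap.rTensor_comp_apply, cohomTensor_eta, LinearMap.rTensor_id_apply]
  change W ⊗[R] M.carrier at t
  induction t with
  | zero => simp
  | add a b ha hb => simp only [map_add, ha, hb]
  | tmul w m =>
    rw [LinearMap.lTensor_tmul, ← mk_rTensor, ← LinearMap.rTensor_comp_apply,
      cohomTensorInv_comp_mk, map_rTensor_eta]
    rfl

theorem cohomTensor_bijective : Function.Bijective (cohomTensor adj W M) :=
  ⟨Function.LeftInverse.injective (g := cohomTensorInv adj W M)
      (LinearMap.congr_fun (cohomTensorInv_comp_cohomTensor adj W M)),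
    Function.RightInverse.surjective (g := cohomTensorInv adj W M)
      (LinearMap.congr_fun (cohomTensor_comp_cohomTensorInv adj W M))⟩

end TensorComparison

theorem cohomTensor_rTensor {W V : Type u} [AddCommGroup W] [Module R W] [AddCommGroup V]
    [Module R V] (g : W →ₗ[R] V) (M : RComod R C) :
    cohomTensor adj V M ∘ₗ (h.map (RComod.rTensorHom g M)).hom =
      g.rTensor (h.obj M) ∘ₗ cohomTensor adj W M := by
  refine cohom_ext adj fun t => ?_
  rw [LinearMap.rTensor_comp_apply, LinearMap.rTensor_comp_apply, map_rTensor_eta,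
    cohomTensor_eta, cohomTensor_eta, rTensor_rTensor_assoc_symm, rTensor_lTensor_apply]
  rfl

theorem cohomTensor_lTensor (W : Type u) [AddCommGroup W] [Module R W] {M N : RComod R C}
    (f : M ⟶ N) :
    cohomTensor adj W N ∘ₗ (h.map (RComod.lTensorHom W f)).hom =
      (h.map f).hom.lTensor W ∘ₗ cohomTensor adj W M := by
  refine cohom_ext adj fun t => ?_
  have hnat : (h.map f).hom.rTensor X.carrier ∘ₗ eta adj M = eta adj N ∘ₗ RComod.lin f :=
    LinearMap.ext (map_rTensor_eta adj f)
  rw [LinearMap.rTensor_comp_apply, LinearMap.rTensor_comp_apply, map_rTensor_eta,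
    cohomTensor_eta, cohomTensor_eta, lTensor_rTensor_assoc_symm, ← LinearMap.lTensor_comp_apply,
    hnat, LinearMap.lTensor_comp_apply]
  rfl

theorem assoc_comp_cohomTensor (W V : Type u) [AddCommGroup W] [Module R W] [AddCommGroup V]
    [Module R V] (M : RComod R C) :
    (TensorProduct.assoc R W V (h.obj M)).toLinearMap ∘ₗ cohomTensor adj (W ⊗[R] V) M ∘ₗ
        (h.map (RComod.assocSymmHom W V M)).hom =
      (cohomTensor adj V M).lTensor W ∘ₗ cohomTensor adj W (RComod.tensorObj V M) := by
  refine cohom_ext adj fun t => ?_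
  have hV : (cohomTensor adj V M).rTensor X.carrier ∘ₗ eta adj (RComod.tensorObj V M) =
      (TensorProduct.assoc R V (h.obj M) X.carrier).symm.toLinearMap ∘ₗ (eta adj M).lTensor V :=
    LinearMap.ext (cohomTensor_eta adj V M)
  rw [LinearMap.rTensor_comp_apply, LinearMap.rTensor_comp_apply, LinearMap.rTensor_comp_apply,
    map_rTensor_eta, cohomTensor_eta, cohomTensor_eta, lTensor_rTensor_assoc_symm,
    ← LinearMap.lTensor_comp_apply, hV, LinearMap.lTensor_comp_apply,
    ← assoc_rTensor_assoc_symm_assoc_symm]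
  exact congrArg (fun s => (TensorProduct.assoc R W V (h.obj M)).toLinearMap.rTensor X.carrier
    ((TensorProduct.assoc R (W ⊗[R] V) (h.obj M) X.carrier).symm s))
    (lTensor_assoc_symm (eta adj M) t)

include adj in
theorem cohom_flat (hinj : IsInjector X) (M : RComod R C) [Module.Flat R M.carrier] :
    Module.Flat R (h.obj M) := by
  rw [Module.Flat.iff_rTensor_preserves_injective_linearMap]
  intro W V _ _ _ _ g hg
  have hmap := cohom_map_injective adj hinj (RComod.rTensorHom g M)
    (Module.Flat.rTensor_preserves_injective_linearMap g hg)
  have hcomp := (cohomTensor_bijective adj V M).1.comp hmap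
  rw [← LinearMap.coe_comp, cohomTensor_rTensor, LinearMap.coe_comp] at hcomp
  exact hcomp.of_comp_right (cohomTensor_bijective adj W M).2

include adj in
theorem cohom_map_lTensor_injective (hinj : IsInjector X) (W : Type u) [AddCommGroup W]
    [Module R W] {M N : RComod R C} (f : M ⟶ N)
    (hf : Function.Injective ((RComod.lin f).lTensor W)) :
    Function.Injective ((h.map f).hom.lTensor W) := by
  have hcomp := (cohomTensor_bijective adj W N).1.comp
    (cohom_map_injective adj hinj (RComod.lTensorHom W f) hf)
  rw [← LinearMap.coe_comp, cohomTensor_lTensor, LinearMap.coe_comp] at hcomp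
  exact hcomp.of_comp_right (cohomTensor_bijective adj W M).2

end CohomFunctor

section CotensorProduct

variable {R C D : Type u} [CommRing R] [AddCommGroup C] [Module R C] [Coalgebra R C]
  [AddCommGroup D] [Module R D] [Coalgebra R D]

/-- The left coaction of a bicomodule, as a morphism of right comodules. -/
def Bicomod.lcoactHom (M : Bicomod R D C) : M.toRComod ⟶ RComod.tensorObj D M.toRComod :=
  ⟨M.lcoact, M.lcoact_mem⟩

/-- The coaction of a right comodule, as a morphism of right comodules. -/
def RComod.rcoactHom (M : RComod R C) :
    M ⟶ RComod.tensorObj M.carrier (Bicomod.self R C).toRComod :=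
  ⟨M.rcoact, M.rcoact_mem⟩

/-- The morphism `ρ_P ⊗ id - id ⊗ ρ_M : P ⊗ M ⟶ (P ⊗ D) ⊗ M` of right `C`-comodules, whose kernel
is `P □_D M`. -/
def cotensorHom (P : RComod R D) (M : Bicomod R D C) :
    RComod.tensorObj P.carrier M.toRComod ⟶ RComod.tensorObj (P.carrier ⊗[R] D) M.toRComod :=
  RComod.rTensorHom P.rcoact M.toRComod -
    RComod.lTensorHom P.carrier M.lcoactHom ≫ RComod.assocSymmHom P.carrier D M.toRComod

theorem ker_cotensorHom (P : RComod R D) (M : Bicomod R D C) :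
    LinearMap.ker (RComod.lin (cotensorHom P M)) = cotensor P M.toLComod := by
  refine Submodule.ext fun t => (sub_eq_zero.trans ?_).trans mem_cotensor.symm
  exact LinearEquiv.eq_symm_apply (TensorProduct.assoc R P.carrier D M.carrier)

variable {X : RComod R C} {h : RComod R C ⥤ ModuleCat.{u} R} (adj : h ⊣ tensorFunctor X)

theorem lcoactMap_eq (M : Bicomod R D C) :
    lcoactMap adj M = cohomTensor adj D M.toRComod ∘ₗ (h.map M.lcoactHom).hom :=
  cohom_ext adj fun m => by
    rw [lcoactMap_eta, LinearMap.rTensor_comp_apply, map_rTensor_eta, cohomTensor_eta]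
    rfl

theorem deltaMap_eq (M : RComod R C) :
    deltaMap adj M = cohomTensor adj M.carrier (Bicomod.self R C).toRComod ∘ₗ
      (h.map M.rcoactHom).hom :=
  cohom_ext adj fun m => by
    rw [deltaMap_eta, LinearMap.rTensor_comp_apply, map_rTensor_eta, cohomTensor_eta]
    rfl

theorem cohomTensor_cotensorHom (P : RComod R D) (M : Bicomod R D C) :
    (TensorProduct.assoc R P.carrier D (h.obj M.toRComod)).toLinearMap ∘ₗ
        cohomTensor adj (P.carrier ⊗[R] D) M.toRComod ∘ₗ (h.map (cotensorHom P M)).hom =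
      ((TensorProduct.assoc R P.carrier D (h.obj M.toRComod)).toLinearMap ∘ₗ
        P.rcoact.rTensor (h.obj M.toRComod) - (lcoactMap adj M).lTensor P.carrier) ∘ₗ
          cohomTensor adj P.carrier M.toRComod := by
  have : h.Additive := adj.left_adjoint_additive
  have hlcoact : (lcoactMap adj M).lTensor P.carrier ∘ₗ cohomTensor adj P.carrier M.toRComod =
      (cohomTensor adj D M.toRComod).lTensor P.carrier ∘ₗ
        cohomTensor adj P.carrier (RComod.tensorObj D M.toRComod) ∘ₗ
          (h.map (RComod.lTensorHom P.carrier M.lcoactHom)).hom := by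
    rw [lcoactMap_eq, LinearMap.lTensor_comp, LinearMap.comp_assoc, cohomTensor_lTensor]
  have hassoc := LinearMap.congr_fun (assoc_comp_cohomTensor adj P.carrier D M.toRComod)
  rw [cotensorHom, h.map_sub, h.map_comp, ModuleCat.hom_sub, ModuleCat.hom_comp,
    LinearMap.comp_sub, LinearMap.comp_sub, LinearMap.sub_comp, cohomTensor_rTensor, hlcoact]
  exact congrArg _ (LinearMap.ext fun x => hassoc _)

include adj in
theorem range_cohomTensor_comp_map (hinj : IsInjector X) (P : RComod R D) (M : Bicomod R D C)
    {K : RComod R C} (i : K ⟶ RComod.tensorObj P.carrier M.toRComod)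
    (hi : LinearMap.range (RComod.lin i) = cotensor P M.toLComod) :
    LinearMap.range (cohomTensor adj P.carrier M.toRComod ∘ₗ (h.map i).hom) =
      cotensor P (cohomBicomod adj M).toLComod := by
  have hexact : LinearMap.ker (h.map (cotensorHom P M)).hom = LinearMap.range (h.map i).hom :=
    LinearMap.exact_iff.1 (cohom_map_exact adj hinj i (cotensorHom P M)
      (LinearMap.exact_iff.2 ((ker_cotensorHom P M).trans hi.symm)))
  have hassoc : LinearMap.ker ((TensorProduct.assoc R P.carrier D (h.obj M.toRComod)).toLinearMap ∘ₗ
      cohomTensor adj (P.carrier ⊗[R] D) M.toRComod) = ⊥ :=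
    LinearMap.ker_eq_bot.2 ((TensorProduct.assoc R P.carrier D (h.obj M.toRComod)).injective.comp
      (cohomTensor_bijective adj (P.carrier ⊗[R] D) M.toRComod).1)
  rw [LinearMap.range_comp, ← hexact, ← LinearMap.ker_comp_of_ker_eq_bot _ hassoc,
    LinearMap.comp_assoc, cohomTensor_cotensorHom, LinearMap.ker_comp,
    Submodule.map_comap_eq_of_surjective (cohomTensor_bijective adj P.carrier M.toRComod).2]
  rfl

theorem cohomTensor_comp_map_injective (hinj : IsInjector X) (W : Type u) [AddCommGroup W]
    [Module R W] {K M : RComod R C} (i : K ⟶ RComod.tensorObj W M)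
    (hi : Function.Injective (RComod.lin i)) :
    Function.Injective (cohomTensor adj W M ∘ₗ (h.map i).hom) := by
  rw [LinearMap.coe_comp]
  exact (cohomTensor_bijective adj W M).1.comp (cohom_map_injective adj hinj i hi)

theorem deltaMap_injective (hinj : IsInjector X) (M : RComod R C) :
    Function.Injective (deltaMap adj M) := by
  rw [deltaMap_eq]
  exact cohomTensor_comp_map_injective adj hinj M.carrier M.rcoactHom M.rcoact_injective

theorem range_deltaMap (hinj : IsInjector X) (M : RComod R C) :
    LinearMap.range (deltaMap adj M) = cotensor M (cohomSelf C adj).toLComod := by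
  rw [deltaMap_eq]
  exact range_cohomTensor_comp_map adj hinj M (Bicomod.self R C) M.rcoactHom (range_rcoact M)

theorem delta_bijective (hinj : IsInjector X) (M : RComod R C) :
    Function.Bijective (delta adj M) :=
  bijective_codRestrict _ (deltaMap_injective adj hinj M) (range_deltaMap adj hinj M)

theorem deltaMap_lTensor_injective (hinj : IsInjector X) (M : RComod R C) (W : Type u)
    [AddCommGroup W] [Module R W] : Function.Injective ((deltaMap adj M).lTensor W) := by
  rw [deltaMap_eq, LinearMap.lTensor_comp, LinearMap.coe_comp]
  exact (LinearEquiv.lTensor W (LinearEquiv.ofBijective _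
    (cohomTensor_bijective adj M.carrier (Bicomod.self R C).toRComod))).injective.comp
      (cohom_map_lTensor_injective adj hinj W M.rcoactHom (M.rcoact_lTensor_injective W))

end CotensorProduct

section Unit

variable {R C : Type u} [CommRing R] [AddCommGroup C] [Module R C] [Coalgebra R C]
  {X : RComod R C} {h : RComod R C ⥤ ModuleCat.{u} R} (adj : h ⊣ tensorFunctor X)

theorem eta_mem_lcolinear : eta adj (Bicomod.self R C).toRComod ∈
    LComod.colinear (Bicomod.self R C).toLComod
      (LComod.tensorObj (cohomSelf C adj).toLComod X.carrier) :=
  LinearMap.ext fun c =>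
    ((LinearEquiv.eq_symm_apply _).1 (lcoactMap_eta adj (Bicomod.self R C) c) :)

theorem deltaMap_rTensor_comp_eta (M : RComod R C) :
    (deltaMap adj M).rTensor X.carrier ∘ₗ eta adj M =
      (TensorProduct.assoc R M.carrier (h.obj (Bicomod.self R C).toRComod)
        X.carrier).symm.toLinearMap ∘ₗ
        (eta adj (Bicomod.self R C).toRComod).lTensor M.carrier ∘ₗ M.rcoact :=
  LinearMap.ext (deltaMap_eta adj M)

theorem eta_rTensor_injective_coend (W : Type u) [AddCommGroup W] [Module R W] :
    Function.Injective ((eta adj X).rTensor W) :=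
  (coendBicomod adj).toLComod.lcoact_rTensor_injective W

include adj in
theorem eta_self_lTensor_comp_rcoact_rTensor_injective (hinj : IsInjector X) (W : Type u)
    [AddCommGroup W] [Module R W] :
    Function.Injective
      (((eta adj (Bicomod.self R C).toRComod).lTensor X.carrier ∘ₗ X.rcoact).rTensor W) := by
  have hδ : Function.Injective (((deltaMap adj X).rTensor X.carrier).rTensor W) := by
    have hδ' : Function.Injective ((deltaMap adj X).rTensor (X.carrier ⊗[R] W)) :=
      (LinearMap.lTensor_inj_iff_rTensor_inj _ _).1
        (deltaMap_lTensor_injective adj hinj X (X.carrier ⊗[R] W))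
    intro a b hab
    refine (TensorProduct.assoc R (h.obj X) X.carrier W).injective (hδ' ?_)
    rw [← assoc_rTensor_rTensor, ← assoc_rTensor_rTensor, hab]
  have hcomp := hδ.comp (eta_rTensor_injective_coend adj W)
  rw [← LinearMap.coe_comp, ← LinearMap.rTensor_comp, deltaMap_rTensor_comp_eta,
    LinearMap.rTensor_comp, LinearMap.coe_comp] at hcomp
  exact hcomp.of_comp

theorem range_eta_le (M : RComod R C) : LinearMap.range (eta adj M) ≤
    cotensor (cohomRComod adj M) (coendBicomod adj).toLComod := by
  rintro _ ⟨m, rfl⟩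
  exact (etaCotensor adj M m).2

variable [Module.Flat R C]

theorem eta_self_rTensor_injective (hfc : IsFaithfullyCoflat X) (hinj : IsInjector X)
    (W : Type u) [AddCommGroup W] [Module R W] :
    Function.Injective ((eta adj (Bicomod.self R C).toRComod).rTensor W) := by
  let ηC := eta adj (Bicomod.self R C).toRComod
  refine hfc.injective_of_cotensor_injective ⟨_, LComod.rTensor_mem (eta_mem_lcolinear adj) W⟩
    ((injective_iff_map_eq_zero _).2 fun ⟨t, ht⟩ hηt => Subtype.ext ?_)
  have hηt' : (ηC.rTensor W).lTensor X.carrier t = 0 := congrArg Subtype.val hηt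
  rw [← range_assoc_rcoact_rTensor] at ht
  obtain ⟨s, rfl⟩ := ht
  rw [LinearMap.comp_apply, LinearEquiv.coe_coe, ← assoc_lTensor_rTensor,
    LinearEquiv.map_eq_zero_iff, ← LinearMap.rTensor_comp_apply] at hηt'
  have hs : s = 0 := eta_self_lTensor_comp_rcoact_rTensor_injective adj hinj W
    (hηt'.trans (map_zero _).symm)
  exact (congrArg _ hs).trans (map_zero _)

theorem eta_injective (hfc : IsFaithfullyCoflat X) (hinj : IsInjector X) (M : RComod R C) :
    Function.Injective (eta adj M) := by
  have hηC : Function.Injective ((eta adj (Bicomod.self R C).toRComod).lTensor M.carrier) :=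
    (LinearMap.lTensor_inj_iff_rTensor_inj _ _).2
      (eta_self_rTensor_injective adj hfc hinj M.carrier)
  have hcomp := (TensorProduct.assoc R M.carrier (h.obj (Bicomod.self R C).toRComod)
    X.carrier).symm.injective.comp (hηC.comp M.rcoact_injective)
  refine Function.Injective.of_comp (f := (deltaMap adj M).rTensor X.carrier) ?_
  rw [← LinearMap.coe_comp, deltaMap_rTensor_comp_eta]
  exact hcomp

include adj in
theorem cohom_faithful (hfc : IsFaithfullyCoflat X) (hinj : IsInjector X) : h.Faithful :=
  have (M : RComod R C) : Mono (adj.unit.app M) :=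
    RComod.mono_of_injective _ (eta_injective adj hfc hinj M)
  adj.faithful_L_of_mono_unit_app

end Unit

section UnitBijective

variable {R C : Type u} [CommRing R] [AddCommGroup C] [Module R C] [Coalgebra R C]
  {X : RComod R C} {h : RComod R C ⥤ ModuleCat.{u} R} (adj : h ⊣ tensorFunctor X)

/-- The coaction of a right comodule over `e_C(X)`, where `e_C(X)` is regarded as the module `h(X)`
rather than as a coalgebra. -/
def coendRcoact (P : RComod R (Coend adj)) : P.carrier →ₗ[R] P.carrier ⊗[R] h.obj X :=
  P.rcoact

variable [Module.Flat R C]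

/-- The cotensor product `P □_E X` of a right comodule `P` over `E = e_C(X)` with `X`, as a right
`C`-comodule. -/
def cotensorCoend (P : RComod R (Coend adj)) : RComod R C :=
  RComod.ker (cotensorHom P (coendBicomod adj))

/-- The inclusion of `P □_E X` into `P ⊗ X`. -/
def cotensorCoendι (P : RComod R (Coend adj)) :
    cotensorCoend adj P ⟶ RComod.tensorObj P.carrier X :=
  RComod.kerι (cotensorHom P (coendBicomod adj))

theorem cotensorCoendι_injective (P : RComod R (Coend adj)) :
    Function.Injective (RComod.lin (cotensorCoendι adj P)) :=
  RComod.kerι_injective _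

theorem range_cotensorCoendι (P : RComod R (Coend adj)) :
    LinearMap.range (RComod.lin (cotensorCoendι adj P)) =
      cotensor P (coendBicomod adj).toLComod :=
  (RComod.range_kerι _).trans (ker_cotensorHom P (coendBicomod adj))

theorem coendRcoact_rTensor_cotensorCoendι (P : RComod R (Coend adj))
    (k : (cotensorCoend adj P).carrier) :
    (coendRcoact adj P).rTensor X.carrier (RComod.lin (cotensorCoendι adj P) k) =
      (TensorProduct.assoc R P.carrier (h.obj X) X.carrier).symm
        ((eta adj X).lTensor P.carrier (RComod.lin (cotensorCoendι adj P) k)) :=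
  (LinearEquiv.eq_symm_apply _).2
    (mem_cotensor.1 ((range_cotensorCoendι adj P).le ⟨k, rfl⟩) :)

/-- The map `h(P □_E X) → P` adjoint to the inclusion `P □_E X → P ⊗ X`, that is, the counit of
the adjunction between `h` and `- □_E X`. -/
def cohomCotensor (P : RComod R (Coend adj)) : h.obj (cotensorCoend adj P) →ₗ[R] P.carrier :=
  desc adj _ (cotensorCoendι adj P).2

theorem cohomCotensor_eta (P : RComod R (Coend adj)) (k : (cotensorCoend adj P).carrier) :
    (cohomCotensor adj P).rTensor X.carrier (eta adj _ k) =
      RComod.lin (cotensorCoendι adj P) k :=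
  desc_apply ..

theorem coendRcoact_comp_cohomCotensor (P : RComod R (Coend adj)) :
    coendRcoact adj P ∘ₗ cohomCotensor adj P =
      cohomTensor adj P.carrier X ∘ₗ (h.map (cotensorCoendι adj P)).hom :=
  cohom_ext adj fun k => by
    rw [LinearMap.rTensor_comp_apply, LinearMap.rTensor_comp_apply, map_rTensor_eta,
      cohomTensor_eta, cohomCotensor_eta, coendRcoact_rTensor_cotensorCoendι]

theorem cohomCotensor_bijective (hinj : IsInjector X) (P : RComod R (Coend adj)) :
    Function.Bijective (cohomCotensor adj P) := by
  constructor
  · refine Function.Injective.of_comp (f := coendRcoact adj P) ?_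
    rw [← LinearMap.coe_comp, coendRcoact_comp_cohomCotensor]
    exact cohomTensor_comp_map_injective adj hinj P.carrier (cotensorCoendι adj P)
      (cotensorCoendι_injective adj P)
  · intro p
    have hp : coendRcoact adj P p ∈ cotensor P (cohomBicomod adj (coendBicomod adj)).toLComod :=
      (range_rcoact P).le ⟨p, rfl⟩
    rw [← range_cohomTensor_comp_map adj hinj P (coendBicomod adj) (cotensorCoendι adj P)
      (range_cotensorCoendι adj P)] at hp
    obtain ⟨y, hy⟩ := hp
    exact ⟨y, P.rcoact_injective
      ((LinearMap.congr_fun (coendRcoact_comp_cohomCotensor adj P) y).trans hy)⟩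

theorem cohomCotensor_mem (P : RComod R (Coend adj)) :
    cohomCotensor adj P ∈ RComod.colinear (cohomRComod adj (cotensorCoend adj P)) P := by
  change coendRcoact adj P ∘ₗ cohomCotensor adj P =
    (cohomCotensor adj P).rTensor (h.obj X) ∘ₗ coactMap adj _
  refine cohom_ext adj fun k => ?_
  rw [LinearMap.rTensor_comp_apply, LinearMap.rTensor_comp_apply, coactMap_eta,
    rTensor_rTensor_assoc_symm, rTensor_lTensor_apply, cohomCotensor_eta,
    coendRcoact_rTensor_cotensorCoendι]

theorem range_eta (hfc : IsFaithfullyCoflat X) (hinj : IsInjector X) (M : RComod R C) :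
    LinearMap.range (eta adj M) = cotensor (cohomRComod adj M) (coendBicomod adj).toLComod := by
  have := cohom_faithful adj hfc hinj
  let ι := cotensorCoendι adj (cohomRComod adj M)
  have hι := range_cotensorCoendι adj (cohomRComod adj M)
  obtain ⟨j, hj⟩ := RComod.exists_lift ι (cotensorCoendι_injective adj _) (adj.unit.app M)
    ((range_eta_le adj M).trans hι.ge)
  have hj' : RComod.lin ι ∘ₗ RComod.lin j = eta adj M := congrArg RComod.lin hj
  have hsection : cohomCotensor adj (cohomRComod adj M) ∘ₗ (h.map j).hom = LinearMap.id := by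
    refine cohom_ext adj fun m => ?_
    rw [LinearMap.rTensor_comp_apply, map_rTensor_eta, cohomCotensor_eta]
    exact (LinearMap.congr_fun hj' m).trans (LinearMap.rTensor_id_apply ..).symm
  have hhj : Function.Surjective (h.map j).hom := fun y =>
    ⟨cohomCotensor adj (cohomRComod adj M) y, (cohomCotensor_bijective adj hinj _).1
      (LinearMap.congr_fun hsection (cohomCotensor adj (cohomRComod adj M) y))⟩
  have : Epi (h.map j) := (ModuleCat.epi_iff_surjective _).2 hhj
  have : Epi j := h.epi_of_epi_map this
  have hj_range : LinearMap.range (RComod.lin j) = ⊤ :=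
    LinearMap.range_eq_top.2 (RComod.surjective_of_epi j)
  exact (congrArg LinearMap.range hj'.symm).trans
    ((LinearMap.range_comp_of_range_eq_top _ hj_range).trans hι)

theorem etaCotensor_bijective (hfc : IsFaithfullyCoflat X) (hinj : IsInjector X)
    (M : RComod R C) : Function.Bijective (etaCotensor adj M) :=
  bijective_codRestrict _ (eta_injective adj hfc hinj M) (range_eta adj hfc hinj M)

end UnitBijective

section Equivalence

variable {R C : Type u} [CommRing R] [AddCommGroup C] [Module R C] [Coalgebra R C]

theorem rTensor_mem_cotensor {M N : RComod R C} (f : M ⟶ N) (Y : LComod R C)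
    {t : M.carrier ⊗[R] Y.carrier} (ht : t ∈ cotensor M Y) :
    (RComod.lin f).rTensor Y.carrier t ∈ cotensor N Y := by
  have hf : N.rcoact ∘ₗ RComod.lin f = (RComod.lin f).rTensor C ∘ₗ M.rcoact := f.2
  rw [mem_cotensor] at ht ⊢
  rw [← LinearMap.rTensor_comp_apply, hf, LinearMap.rTensor_comp_apply, assoc_rTensor_rTensor, ht,
    rTensor_lTensor_apply]

variable {X : RComod R C} {h : RComod R C ⥤ ModuleCat.{u} R} (adj : h ⊣ tensorFunctor X)

theorem map_mem_colinear {M N : RComod R C} (f : M ⟶ N) :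
    (h.map f).hom ∈ RComod.colinear (cohomRComod adj M) (cohomRComod adj N) := by
  change coactMap adj N ∘ₗ (h.map f).hom = (h.map f).hom.rTensor (h.obj X) ∘ₗ coactMap adj M
  refine cohom_ext adj fun m => ?_
  rw [LinearMap.rTensor_comp_apply, LinearMap.rTensor_comp_apply, map_rTensor_eta, coactMap_eta,
    coactMap_eta, rTensor_rTensor_assoc_symm, rTensor_lTensor_apply, map_rTensor_eta]

/-- The cohom functor `h`, with values in the category of right comodules over `e_C(X)`. -/
def cohomFunctor : RComod R C ⥤ RComod R (Coend adj) where
  obj M := cohomRComod adj M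
  map f := ⟨(h.map f).hom, map_mem_colinear adj f⟩
  map_id M := Subtype.ext (congrArg ModuleCat.Hom.hom (h.map_id M))
  map_comp f g := Subtype.ext (congrArg ModuleCat.Hom.hom (h.map_comp f g))

instance cohomFunctor_additive : (cohomFunctor adj).Additive where
  map_add :=
    have : h.Additive := adj.left_adjoint_additive
    Subtype.ext (congrArg ModuleCat.Hom.hom h.map_add)

instance cohomFunctor_linear : (cohomFunctor adj).Linear R where
  map_smul f r :=
    have := cohom_linear adj
    Subtype.ext (congrArg ModuleCat.Hom.hom (h.map_smul r f))

variable [Module.Flat R C]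

theorem cohomFunctor_faithful (hfc : IsFaithfullyCoflat X) (hinj : IsInjector X) :
    (cohomFunctor adj).Faithful where
  map_injective hfg :=
    have := cohom_faithful adj hfc hinj
    h.map_injective (ModuleCat.hom_ext (congrArg RComod.lin hfg))

theorem cohomFunctor_full (hfc : IsFaithfullyCoflat X) (hinj : IsInjector X) :
    (cohomFunctor adj).Full where
  map_surjective {M N} g := by
    let g' : h.obj M →ₗ[R] h.obj N := RComod.lin g
    obtain ⟨f, hf⟩ := RComod.exists_lift (adj.unit.app N) (eta_injective adj hfc hinj N)
      (adj.unit.app M ≫ RComod.rTensorHom g' X) (by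
        rintro _ ⟨m, rfl⟩
        exact (range_eta adj hfc hinj N).ge (rTensor_mem_cotensor g _ (etaCotensor adj M m).2))
    refine ⟨f, Subtype.ext (cohom_ext adj (q := g') fun m => ?_)⟩
    exact (map_rTensor_eta adj f m).trans (LinearMap.congr_fun (congrArg RComod.lin hf) m)

theorem cohomFunctor_essSurj (hinj : IsInjector X) : (cohomFunctor adj).EssSurj where
  mem_essImage P := ⟨cotensorCoend adj P, RComod.nonempty_iso_of_bijective
    (M := cohomRComod adj (cotensorCoend adj P)) ⟨_, cohomCotensor_mem adj P⟩
    (cohomCotensor_bijective adj hinj P)⟩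

theorem moritaTakeuchiEquivalent_coend (hfc : IsFaithfullyCoflat X) (hinj : IsInjector X) :
    MoritaTakeuchiEquivalent R C (Coend adj) :=
  have := cohomFunctor_faithful adj hfc hinj
  have := cohomFunctor_full adj hfc hinj
  have := cohomFunctor_essSurj adj hinj
  have : (cohomFunctor adj).IsEquivalence := { }
  ⟨(cohomFunctor adj).asEquivalence, cohomFunctor_additive adj, cohomFunctor_linear adj⟩

end Equivalence

section Context

variable {R C : Type u} [CommRing R] [AddCommGroup C] [Module R C] [Coalgebra R C]

theorem isPure_of_surjective {A V : Type u} [AddCommGroup A] [Module R A] [AddCommGroup V]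
    [Module R V] {P : Submodule R V} (f : A →ₗ[R] P) (hf : Function.Surjective f)
    (hPf : ∀ (W : Type u) [AddCommGroup W] [Module R W],
      Function.Injective ((P.subtype ∘ₗ f).lTensor W)) : IsPure P := by
  intro W _ _
  have hcomp : Function.Injective (P.subtype.rTensor W ∘ f.rTensor W) := by
    rw [← LinearMap.coe_comp, ← LinearMap.rTensor_comp]
    exact (LinearMap.lTensor_inj_iff_rTensor_inj _ _).1 (hPf W)
  exact hcomp.of_comp_right (LinearMap.rTensor_surjective W hf)

variable {X : RComod R C} {h : RComod R C ⥤ ModuleCat.{u} R} (adj : h ⊣ tensorFunctor X)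

theorem coactMap_rTensor_comp_eta (M : RComod R C) :
    (coactMap adj M).rTensor X.carrier ∘ₗ eta adj M =
      (TensorProduct.assoc R (h.obj M) (h.obj X) X.carrier).symm.toLinearMap ∘ₗ
        (eta adj X).lTensor (h.obj M) ∘ₗ eta adj M :=
  LinearMap.ext (coactMap_eta adj M)

theorem eta_rTensor_rcoact (M : RComod R C) (m : M.carrier) :
    (eta adj M).rTensor C (M.rcoact m) =
      (TensorProduct.assoc R (h.obj M) X.carrier C).symm
        (X.rcoact.lTensor (h.obj M) (eta adj M m)) :=
  (LinearMap.congr_fun (eta_mem adj M) m).symm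

theorem assoc_comp_eta_rTensor_comp_deltaMap (M : RComod R C) :
    (TensorProduct.assoc R (h.obj M) X.carrier
      (h.obj (Bicomod.self R C).toRComod)).toLinearMap ∘ₗ
        (eta adj M).rTensor (h.obj (Bicomod.self R C).toRComod) ∘ₗ deltaMap adj M =
      (deltaMap adj X).lTensor (h.obj M) ∘ₗ coactMap adj M := by
  refine cohom_ext adj fun m => ?_
  rw [LinearMap.rTensor_comp_apply, LinearMap.rTensor_comp_apply, LinearMap.rTensor_comp_apply,
    deltaMap_eta, coactMap_eta, rTensor_rTensor_assoc_symm, lTensor_rTensor_assoc_symm,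
    ← LinearMap.lTensor_comp_apply, deltaMap_rTensor_comp_eta, rTensor_lTensor_apply,
    eta_rTensor_rcoact, lTensor_assoc_symm, assoc_rTensor_assoc_symm_assoc_symm,
    ← LinearMap.lTensor_comp_apply, ← LinearMap.lTensor_comp_apply, LinearMap.comp_assoc]

theorem coactMap_lTensor_comp_deltaMap (M : RComod R C) :
    (coactMap adj (Bicomod.self R C).toRComod).lTensor M.carrier ∘ₗ deltaMap adj M =
      (TensorProduct.assoc R M.carrier (h.obj (Bicomod.self R C).toRComod)
        (h.obj X)).toLinearMap ∘ₗ (deltaMap adj M).rTensor (h.obj X) ∘ₗ coactMap adj M := by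
  refine cohom_ext adj fun m => ?_
  rw [LinearMap.rTensor_comp_apply, LinearMap.rTensor_comp_apply, LinearMap.rTensor_comp_apply,
    deltaMap_eta, coactMap_eta, lTensor_rTensor_assoc_symm, rTensor_rTensor_assoc_symm,
    rTensor_lTensor_apply, deltaMap_eta, lTensor_assoc_symm, assoc_rTensor_assoc_symm_assoc_symm,
    ← LinearMap.lTensor_comp_apply, ← LinearMap.lTensor_comp_apply,
    ← LinearMap.lTensor_comp_apply, coactMap_rTensor_comp_eta, LinearMap.comp_assoc]

theorem deltaMap_self :
    deltaMap adj (Bicomod.self R C).toRComod = lcoactMap adj (Bicomod.self R C) :=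
  cohom_ext adj fun m => by rw [deltaMap_eta, lcoactMap_eta]

theorem isStrictContext_coend [Module.Flat R C] (hfc : IsFaithfullyCoflat X)
    (hinj : IsInjector X) :
    IsStrictContext (D := Coend adj) (C := C) (coendBicomod adj) (cohomSelf C adj)
      (delta adj X) (etaCotensor adj (Bicomod.self R C).toRComod) where
  flat_left :=
    have := hfc.1.flat
    cohom_flat adj hinj X
  flat_right := inferInstance
  bicolinear_f := ⟨assoc_comp_eta_rTensor_comp_deltaMap adj X, LinearMap.ext fun x =>
    (LinearEquiv.symm_apply_eq (TensorProduct.assoc R X.carrier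
      (h.obj (Bicomod.self R C).toRComod) (h.obj X))).2
        (LinearMap.congr_fun (coactMap_lTensor_comp_deltaMap adj X) x)⟩
  bicolinear_g := ⟨eta_mem_lcolinear adj, eta_mem adj _⟩
  flat_M := hfc.1.flat
  flat_N := cohom_flat adj hinj (Bicomod.self R C).toRComod
  pure_MN := isPure_of_surjective _ (delta_bijective adj hinj X).2
    fun W _ _ => deltaMap_lTensor_injective adj hinj X W
  pure_NM := isPure_of_surjective _
    (etaCotensor_bijective adj hfc hinj (Bicomod.self R C).toRComod).2
    fun W _ _ => (LinearMap.lTensor_inj_iff_rTensor_inj _ _).2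
      (eta_self_rTensor_injective adj hfc hinj W)
  diagram_M := LinearMap.ext fun x =>
    ((LinearEquiv.eq_symm_apply _).1 (deltaMap_eta adj X x) :).symm
  diagram_N := by
    have hdiagram := assoc_comp_eta_rTensor_comp_deltaMap adj (Bicomod.self R C).toRComod
    rw [deltaMap_self] at hdiagram
    exact hdiagram.symm
  bijective_f := delta_bijective adj hinj X
  bijective_g := etaCotensor_bijective adj hfc hinj (Bicomod.self R C).toRComod

end Context

end

end MoritaTakeuchi

theorem mainTheorem9 (R C : Type u) [CommRing R] [AddCommGroup C] [Module R C] [Coalgebra R C]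
    [Module.Flat R C] (X : MoritaTakeuchi.RComod R C)
    (hqf : MoritaTakeuchi.IsQuasiFinite X) (hfc : MoritaTakeuchi.IsFaithfullyCoflat X)
    (hinj : MoritaTakeuchi.IsInjector X)
    -- any choice of the cohom functor, i.e. of a left adjoint of `- ⊗ X`
    (h : CategoryTheory.Functor (MoritaTakeuchi.RComod R C) (ModuleCat.{u} R))
    (adj : h ⊣ MoritaTakeuchi.tensorFunctor X) :
    MoritaTakeuchi.IsStrictContext (D := MoritaTakeuchi.Coend adj) (C := C)
      (MoritaTakeuchi.coendBicomod adj) (MoritaTakeuchi.cohomSelf C adj)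
      (MoritaTakeuchi.delta adj X)
      (MoritaTakeuchi.etaCotensor adj (MoritaTakeuchi.Bicomod.self R C).toRComod) ∧
    MoritaTakeuchi.MoritaTakeuchiEquivalent R C (MoritaTakeuchi.Coend adj) :=
  ⟨MoritaTakeuchi.isStrictContext_coend adj hfc hinj,
    MoritaTakeuchi.moritaTakeuchiEquivalent_coend adj hfc hinj⟩
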